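/- Let $F/\mathbb{Q}$ be a number field of degree $n$, and let $S$ be a finite set of places of $\mathbb{Q}$ consisting of $\infty$ and of finitely many primes $p$ that are unramified in $F$; write $S^\infty$ for the set of these primes, $N=\prod_{p\in S^\infty}p$ and $\Gamma_S=SL_n(\mathbb{Z}[1/N])$. Let $$\mathfrak{h}^n_S=GL_n(\mathbb{R})/\mathbb{R}^\times O(n)\times\prod_{p\in S^\infty}GL_n(\mathbb{Q}_p)/\mathbb{Q}_p^\times GL_n(\mathbb{Z}_p),$$ with the product of the quotient topologies and the diagonal left action of $\Gamma_S$, and let $\pi:\mathfrak{h}^n_S\to\Gamma_S\backslash\mathfrak{h}^n_S$ be the projection onto the topological quotient. For a place $v$ of $F$ above $p\in S$ let $F_v$ be the completion, $n_v=[F_v:\mathbb{Q}_p]$ (with $\mathbb{Q}_\infty=\mathbb{R}$), and let $$T_S^1=\Big\{(t_v)\in\prod_{v|\infty}\mathbb{R}_{>0}\times\prod_{p\in S^\infty}\prod_{v|p}p^{\mathbb{Z}}\ \Big|\ \prod_{v|p}t_v^{n_v}=1\text{ for all }p\in S\Big\},$$ a group with the subspace topology ($p^{\mathbb{Z}}$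 being discrete). Let $w={}^t(w_1,\dots,w_n)$ be a $\mathbb{Q}$-basis of $F$ and let $e_v\in\mathbb{Z}$ for each place $v$ of $F$ above a prime in $S^\infty$. Identify $\prod_{v|\infty}F_v=\mathbb{R}^{r_1}\times\mathbb{C}^{r_2}$ with $\mathbb{R}^n$ by listing real and imaginary parts in some fixed order, and, for $p\in S^\infty$, $\prod_{v|p}F_v$ with $\mathbb{Q}_p^n$ through fixed $\mathbb{Z}_p$-module isomorphisms $\mathcal{O}_v\simeq\mathbb{Z}_p^{n_v}$ and a fixed order of the coordinates. The $S$-Heegner object $\varpi_S:T_S^1\to\mathfrak{h}^n_S$ of $w$ with indices $(e_v)$ sends $t=(t_v)$ to the point whose archimedean component is the class of the matrix with $i$-th row $(t_v\,v(w_i))_{v|\infty}\in\mathbb{R}^n$, and whose component at $p\in S^\infty$ is the class of the matrix with $i$-th row $(p^{e_v}t_v^{-1}v(w_i))_{v|p}\in\mathbb{Q}_p^n$. Its period lattice is the subgroup $$\Lambda_{\varpi_S}=\{\rho\in T_S^1\mid\exists A\in\Gamma_S\ \forall t\in T_S^1:\ A\,\varpi_S(t)=\varpi_S(\rho t)\}$$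 of $T_S^1$. Then the quotient $T_S^1/\Lambda_{\varpi_S}$ is compact. In particular, the image of $\pi\circ\varpi_S$ in $\Gamma_S\backslash\mathfrak{h}^n_S$ is compact. -/

import Mathlib

open NumberField IsDedekindDomain

set_option linter.unusedSectionVars false

namespace Heegner

section
variable (F : Type*) [Field F] [NumberField F] (p : ℕ)

/-- The places `v` of the number field `F` above the rational prime `p`. The completion `F_v` is
`v.1.adicCompletion F` and its ring of integers `𝒪_v` is `v.1.adicCompletionIntegers F`. -/
abbrev PlaceAbove : Type _ :=
  {v : HeightOneSpectrum (𝓞 F) // (p : 𝓞 F) ∈ v.asIdeal}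

variable [hp : Fact p.Prime]

instance : Finite (PlaceAbove F p) := by
  have hp' : (Ideal.span {(p : 𝓞 F)}) ≠ 0 := by
    simp [hp.out.ne_zero]
  refine (Ideal.finite_factors hp').subset ?_ |>.to_subtype
  intro v hv
  exact Ideal.dvd_span_singleton.2 hv

noncomputable instance : Fintype (PlaceAbove F p) := Fintype.ofFinite _

variable {F p}

lemma norm_p_lt_one (v : PlaceAbove F p) : ‖(p : v.1.adicCompletion F)‖ < 1 := by
  have := (FinitePlace.norm_lt_one_iff_mem F v.1 (p : 𝓞 F)).2 v.2
  simpa using this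

lemma norm_natCast_eq_one (v : PlaceAbove F p) (m : ℕ) (hm : ¬ p ∣ m) :
    ‖(m : v.1.adicCompletion F)‖ = 1 := by
  have := (FinitePlace.norm_eq_one_iff_notMem F v.1 (m : 𝓞 F)).2 (by
    intro h
    have hc : IsCoprime (m : ℤ) (p : ℤ) := 
      Nat.isCoprime_iff_coprime.2 ((Nat.coprime_comm.1 ((Nat.Prime.coprime_iff_not_dvd hp.out).2 hm)))
    obtain ⟨a, b, hab⟩ := hc
    apply v.1.isPrime.ne_top
    rw [Ideal.eq_top_iff_one]
    have : (1 : 𝓞 F) = (a : 𝓞 F) * (m : 𝓞 F) + (b : 𝓞 F) * (p : 𝓞 F) := by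
      exact_mod_cast congrArg (Int.cast : ℤ → 𝓞 F) hab.symm
    rw [this]
    exact Ideal.add_mem _ (Ideal.mul_mem_left _ _ h) (Ideal.mul_mem_left _ _ v.2))
  simpa using this

lemma norm_ratCast_le (v : PlaceAbove F p) (q : ℚ) (k : ℕ)
    (hq : ‖(q : ℚ_[p])‖ ≤ (p : ℝ) ^ (-k : ℤ)) :
    ‖algebraMap ℚ (v.1.adicCompletion F) q‖ ≤ ‖(p : v.1.adicCompletion F)‖ ^ k := by
  have hp1 : (1 : ℝ) < p := by exact_mod_cast hp.out.one_lt
  have hq1 : ‖(q : ℚ_[p])‖ ≤ 1 := hq.trans (zpow_le_one_of_nonpos₀ hp1.le (by simp))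
  have hden : ¬ p ∣ q.den := by
    intro h
    have hnum : ¬ p ∣ q.num.natAbs := fun h' =>
      hp.out.one_lt.ne' (Nat.dvd_one.1 (q.reduced ▸ Nat.dvd_gcd h' h))
    have h1 : ‖(q.num : ℚ_[p])‖ = 1 := by
      refine le_antisymm (Padic.norm_int_le_one _) (not_lt.1 fun hlt => hnum ?_)
      exact Int.natCast_dvd.1 ((Padic.norm_intCast_lt_one_iff).1 hlt)
    have h2 : ‖(q.den : ℚ_[p])‖ < 1 := by
      have := (Padic.norm_intCast_lt_one_iff (p := p) (k := (q.den : ℤ))).2 (by exact_mod_cast h)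
      simpa using this
    have h3 : (q : ℚ_[p]) * q.den = q.num := by exact_mod_cast Rat.mul_den_eq_num q
    have h4 := congrArg norm h3
    rw [norm_mul, h1] at h4
    nlinarith [norm_nonneg (q : ℚ_[p]), norm_nonneg (q.den : ℚ_[p])]
  have hd1 : ‖(q.den : ℚ_[p])‖ = 1 := by
    refine le_antisymm (by simpa using Padic.norm_int_le_one (p := p) (q.den : ℤ)) (not_lt.1 fun hlt => hden ?_)
    have := (Padic.norm_intCast_lt_one_iff (p := p) (k := (q.den : ℤ))).1 (by simpa using hlt)
    exact_mod_cast this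
  have hnum : ((p ^ k : ℕ) : ℤ) ∣ q.num := by
    have h3 : (q : ℚ_[p]) * q.den = q.num := by exact_mod_cast Rat.mul_den_eq_num q
    have h4 := congrArg norm h3
    rw [norm_mul, hd1, mul_one] at h4
    exact_mod_cast (Padic.norm_int_le_pow_iff_dvd (p := p) q.num k).1 (h4 ▸ hq)
  obtain ⟨m, hm⟩ := hnum
  have hint : ‖(m : v.1.adicCompletion F)‖ ≤ 1 := by
    have := FinitePlace.norm_le_one F v.1 (m : 𝓞 F)
    simpa using this
  have h5 : algebraMap ℚ (v.1.adicCompletion F) q * (q.den : v.1.adicCompletion F)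
      = (p : v.1.adicCompletion F) ^ k * m := by
    have : q * q.den = (p : ℚ) ^ k * m := by
      rw [Rat.mul_den_eq_num, hm]; push_cast; rfl
    have h := congrArg (algebraMap ℚ (v.1.adicCompletion F)) this
    simpa only [map_mul, map_pow, map_natCast, map_intCast] using h
  have h6 := congrArg norm h5
  rw [norm_mul, norm_natCast_eq_one v _ hden, mul_one, norm_mul, norm_pow] at h6
  rw [h6]
  exact mul_le_of_le_one_right (by positivity) hint

/-- The inclusion of `ℚ` with its `p`-adic uniformity into `F_v`. -/
noncomputable def ratToCompletion (v : PlaceAbove F p) :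
    WithVal (Rat.padicValuation p) →+* v.1.adicCompletion F :=
  (algebraMap ℚ (v.1.adicCompletion F)).comp (WithVal.equiv (Rat.padicValuation p)).toRingHom

lemma uniformContinuous_ratToCompletion (v : PlaceAbove F p) :
    UniformContinuous (ratToCompletion v) := by
  refine uniformContinuous_of_continuousAt_zero (ratToCompletion v) ?_
  rw [ContinuousAt, map_zero, (Padic.isUniformInducing_cast_withVal (p := p)).isInducing.nhds_eq_comap,
    map_zero, (Metric.nhds_basis_ball.comap _).tendsto_iff Metric.nhds_basis_ball]
  intro ε hε
  obtain ⟨k, hk⟩ := exists_pow_lt_of_lt_one hε (norm_p_lt_one v)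
  have hp0 : (0 : ℝ) < p := by exact_mod_cast hp.out.pos
  refine ⟨(p : ℝ) ^ (-k : ℤ), zpow_pos hp0 _, fun x hx => ?_⟩
  rw [mem_ball_zero_iff]
  refine lt_of_le_of_lt (norm_ratCast_le v _ k ?_) hk
  rw [Set.mem_preimage, mem_ball_zero_iff] at hx
  exact hx.le

/-- The embedding `ℚ_p → F_v`, the continuous extension of `ℚ → F_v`. -/
noncomputable def padicToCompletion (v : PlaceAbove F p) : ℚ_[p] →+* v.1.adicCompletion F :=
  IsDenseInducing.extendRingHom Padic.isUniformInducing_cast_withVal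
    (Padic.isDenseInducing_cast_withVal (p := p)).dense (uniformContinuous_ratToCompletion v)

/-- The canonical `ℚ_p`-algebra structure on `F_v`. -/
noncomputable instance (v : PlaceAbove F p) : Algebra ℚ_[p] (v.1.adicCompletion F) :=
  (padicToCompletion v).toAlgebra

lemma continuous_padicToCompletion (v : PlaceAbove F p) : Continuous (padicToCompletion v) := 
  (uniformContinuous_uniformly_extend Padic.isUniformInducing_cast_withVal
    (Padic.isDenseInducing_cast_withVal (p := p)).dense (uniformContinuous_ratToCompletion v)).continuous

instance (v : PlaceAbove F p) : ContinuousSMul ℚ_[p] (v.1.adicCompletion F) :=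
  ⟨by
    simp only [Algebra.smul_def]
    exact ((continuous_padicToCompletion v).comp continuous_fst).mul continuous_snd⟩


lemma algebraMap_padic_ratCast (v : PlaceAbove F p) (q : ℚ) :
    algebraMap ℚ_[p] (v.1.adicCompletion F) q = algebraMap ℚ _ q := by
  simp

lemma isClosed_ball_zero_one (v : PlaceAbove F p) :
    IsClosed {x : v.1.adicCompletion F | ‖x‖ ≤ 1} := isClosed_le continuous_norm continuous_const

lemma norm_algebraMap_padic_le (v : PlaceAbove F p) (a : ℚ_[p]) (h : ‖a‖ ≤ 1) :
    ‖algebraMap ℚ_[p] (v.1.adicCompletion F) a‖ ≤ 1 := by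
  have key : ∀ q : ℚ, ‖(q : ℚ_[p])‖ ≤ 1 → ‖algebraMap ℚ_[p] (v.1.adicCompletion F) q‖ ≤ 1 := by
    intro q hq
    rw [algebraMap_padic_ratCast]
    simpa using norm_ratCast_le v q 0 (by simpa using hq)
  have hcl : IsClosed {x : ℚ_[p] | ‖algebraMap ℚ_[p] (v.1.adicCompletion F) x‖ ≤ 1} :=
    isClosed_le (continuous_norm.comp (continuous_padicToCompletion v)) continuous_const
  rw [← Set.mem_ofPred_eq (p := fun x : ℚ_[p] => ‖algebraMap ℚ_[p] (v.1.adicCompletion F) x‖ ≤ 1),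
    ← hcl.closure_eq, Metric.mem_closure_iff]
  intro ε hε
  obtain ⟨q, hq⟩ := Metric.denseRange_iff.1 (Padic.denseRange_ratCast p) a (min ε 1)
    (lt_min hε one_pos)
  refine ⟨q, key q ?_, hq.trans_le (min_le_left _ _)⟩
  have h2 : ‖(q : ℚ_[p]) - a‖ ≤ 1 := by
    rw [← dist_eq_norm, dist_comm]; exact (hq.trans_le (min_le_right _ _)).le
  calc ‖(q : ℚ_[p])‖ = ‖((q : ℚ_[p]) - a) + a‖ := by ring_nf
    _ ≤ max ‖(q : ℚ_[p]) - a‖ ‖a‖ := Padic.nonarchimedean _ _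
    _ ≤ 1 := max_le h2 h

variable (F p) in
/-- `F_p = ∏_{v ∣ p} F_v`. -/
abbrev LocalAlgebra : Type _ := ∀ v : PlaceAbove F p, v.1.adicCompletion F

variable (p) in
/-- The diagonal embedding `F → ∏_{v ∣ p} F_v`. -/
noncomputable def localEmbedding : F →+* LocalAlgebra F p :=
  RingHom.pi fun v => algebraMap F (v.1.adicCompletion F)

lemma localEmbedding_apply (x : F) (v : PlaceAbove F p) :
    localEmbedding p x v = algebraMap F (v.1.adicCompletion F) x := rfl

lemma norm_algebraMap_eq (v : PlaceAbove F p) (x : F) :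
    ‖algebraMap F (v.1.adicCompletion F) x‖ = NumberField.HeightOneSpectrum.adicAbv F v.1 x := by
  rw [← FinitePlace.norm_embedding]
  rfl

lemma denseRange_localEmbedding : DenseRange (localEmbedding p : F → LocalAlgebra F p) := by
  have hw := AbsoluteValue.denseRange_algebraMap_pi
    (v := fun v : PlaceAbove F p => NumberField.HeightOneSpectrum.adicAbv F v.1) ?_ ?_
  · rw [Metric.denseRange_iff]
    intro y r hr
    have h1 : ∀ v : PlaceAbove F p, ∃ x : F, dist (y v) (algebraMap F (v.1.adicCompletion F) x) < r / 2 :=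
      fun v => Metric.denseRange_iff.1 (v.1.denseRange_algebraMap F) (y v) _ (half_pos hr)
    choose x hx using h1
    obtain ⟨z, hz⟩ := Metric.denseRange_iff.1 hw (fun v => (WithAbs.equiv _).symm (x v)) _ (half_pos hr)
    refine ⟨z, (dist_pi_lt_iff hr).2 fun v => ?_⟩
    have h2 := (dist_pi_lt_iff (half_pos hr)).1 hz v
    have h3 : dist (algebraMap F (v.1.adicCompletion F) (x v)) (algebraMap F (v.1.adicCompletion F) z) < r / 2 := by
      rw [dist_eq_norm, ← map_sub, norm_algebraMap_eq]
      rw [dist_eq_norm] at h2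
      exact h2
    have := dist_triangle (y v) (algebraMap F (v.1.adicCompletion F) (x v)) (algebraMap F (v.1.adicCompletion F) z)
    have h4 := hx v
    change dist (y v) (algebraMap F (v.1.adicCompletion F) z) < r
    linarith
  · intro v
    refine ⟨(p : F), by simp [hp.out.ne_zero], ?_⟩
    rw [← norm_algebraMap_eq, map_natCast]
    exact (norm_p_lt_one v).ne
  · intro v v' hvv h
    apply hvv
    refine Subtype.ext (HeightOneSpectrum.ext (Ideal.ext fun x => ?_))
    rw [← FinitePlace.norm_lt_one_iff_mem F v.1, ← FinitePlace.norm_lt_one_iff_mem F v'.1,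
      FinitePlace.norm_embedding, FinitePlace.norm_embedding]
    exact h.lt_one_iff

lemma span_localEmbedding {ι : Type*} [Finite ι] (w : Module.Basis ι ℚ F) :
    Submodule.span ℚ_[p] (Set.range fun i => localEmbedding p (w i)) = ⊤ := by
  set M := Submodule.span ℚ_[p] (Set.range fun i => localEmbedding p (w i))
  have : FiniteDimensional ℚ_[p] M := FiniteDimensional.span_of_finite _ (Set.finite_range _)
  have hc : IsClosed (M : Set (LocalAlgebra F p)) := M.closed_of_finiteDimensional
  have hF : ∀ x : F, localEmbedding p x ∈ M := by
    intro x
    have := Fintype.ofFinite ι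
    rw [← w.sum_repr x, map_sum]
    refine M.sum_mem fun i _ => ?_
    have : localEmbedding p (w.repr x i • w i) = ((w.repr x i : ℚ) : ℚ_[p]) • localEmbedding p (w i) := by
      refine funext fun v => ?_
      rw [Pi.smul_apply, localEmbedding_apply, localEmbedding_apply, Algebra.smul_def,
        Algebra.smul_def, map_mul, algebraMap_padic_ratCast]
      simp
    rw [this]
    exact M.smul_mem _ (Submodule.subset_span ⟨i, rfl⟩)
  rw [eq_top_iff]
  intro y _
  have : y ∈ closure (M : Set (LocalAlgebra F p)) :=
    closure_mono (Set.range_subset_iff.2 hF) (denseRange_localEmbedding y)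
  rwa [hc.closure_eq] at this


lemma norm_le_one_iff_mem (v : HeightOneSpectrum (𝓞 F)) (x : v.adicCompletion F) :
    ‖x‖ ≤ 1 ↔ x ∈ v.adicCompletionIntegers F :=
  Valued.toNormedField.norm_le_one_iff

lemma exists_eq_natCast_mul (x : 𝓞 F)
    (hx : ∀ v : PlaceAbove F p, ‖algebraMap F (v.1.adicCompletion F) x‖
      ≤ ‖(p : v.1.adicCompletion F)‖) :
    ∃ y : 𝓞 F, x = (p : 𝓞 F) * y := by
  have hp' : (p : F) ≠ 0 := by simp [hp.out.ne_zero]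
  have h : ∀ v : HeightOneSpectrum (𝓞 F), v.valuation F ((x : F) / (p : F)) ≤ 1 := by
    intro v
    by_cases hv : (p : 𝓞 F) ∈ v.asIdeal
    · have h1 := hx ⟨v, hv⟩
      have h2 : ‖algebraMap F (v.adicCompletion F) ((x : F) / (p : F))‖ ≤ 1 := by
        rw [map_div₀, norm_div, map_natCast]
        exact div_le_one_of_le₀ h1 (norm_nonneg _)
      rw [norm_le_one_iff_mem, HeightOneSpectrum.mem_adicCompletionIntegers] at h2
      rwa [← HeightOneSpectrum.valuedAdicCompletion_eq_valuation' v]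
    · have h1 : v.valuation F (p : F) = 1 := by
        have := (HeightOneSpectrum.valuation_eq_one_iff_notMem (K := F) v).2 hv
        simpa using this
      rw [map_div₀, h1, div_one]
      exact v.valuation_le_one x
  obtain ⟨y, hy⟩ := HeightOneSpectrum.mem_integers_of_valuation_le_one F _ h
  refine ⟨y, RingOfIntegers.ext ?_⟩
  rw [RingOfIntegers.coe_eq_algebraMap, RingOfIntegers.coe_eq_algebraMap, map_mul, map_natCast, hy]
  field_simp

lemma exists_int_sub_eq (a : ℚ_[p]) (h : ‖a‖ ≤ 1) :
    ∃ (m : ℤ) (c : ℚ_[p]), ‖c‖ ≤ 1 ∧ (m : ℚ_[p]) = a + p * c := by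
  obtain ⟨z, rfl⟩ : ∃ z : ℤ_[p], (z : ℚ_[p]) = a := ⟨⟨a, h⟩, rfl⟩
  obtain ⟨m, hm⟩ := PadicInt.exists_mem_range z
  rw [PadicInt.maximalIdeal_eq_span_p, Ideal.mem_span_singleton] at hm
  obtain ⟨c, hc⟩ := hm.2
  refine ⟨m, -c, by simpa using c.2, ?_⟩
  have h1 : (z : ℚ_[p]) - m = p * c := by exact_mod_cast congrArg (fun z : ℤ_[p] => (z : ℚ_[p])) hc
  push_cast
  linear_combination -h1

lemma linearIndependent_integralBasis :
    LinearIndependent ℚ_[p] (fun i => localEmbedding p (integralBasis F i)) := by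
  classical
  rw [Fintype.linearIndependent_iff]
  intro a ha
  by_contra! hne
  obtain ⟨i₁, hi₁⟩ := hne
  obtain ⟨i₀, -, hi₀⟩ := Finset.exists_max_image Finset.univ (fun i => ‖a i‖) ⟨i₁, Finset.mem_univ _⟩
  have h0 : a i₀ ≠ 0 := by
    intro h
    have := hi₀ i₁ (Finset.mem_univ _)
    rw [h, norm_zero] at this
    exact hi₁ (norm_le_zero_iff.1 this)
  have hb : ∀ i, ‖a i / a i₀‖ ≤ 1 := fun i => by
    rw [norm_div]; exact div_le_one_of_le₀ (hi₀ i (Finset.mem_univ _)) (norm_nonneg _)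
  choose m c hc hm using fun i => exists_int_sub_eq (a i / a i₀) (hb i)
  let B := RingOfIntegers.basis F
  obtain ⟨y, hy⟩ := exists_eq_natCast_mul (p := p) (∑ i, m i • B i) (by
    intro v
    have h1 : algebraMap F (v.1.adicCompletion F) ((∑ i, m i • B i : 𝓞 F) : F) =
        (p : v.1.adicCompletion F) * ∑ i, algebraMap ℚ_[p] _ (c i) *
          algebraMap F (v.1.adicCompletion F) (integralBasis F i) := by
      have h2 : ∑ i, algebraMap ℚ_[p] (v.1.adicCompletion F) (a i / a i₀) *
          algebraMap F (v.1.adicCompletion F) (integralBasis F i) = 0 := by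
        have := congrFun ha v
        simp only [Finset.sum_apply, Pi.smul_apply, localEmbedding_apply, Pi.zero_apply] at this
        simp only [Algebra.smul_def] at this
        simp only [div_eq_inv_mul, map_mul, mul_assoc, ← Finset.mul_sum]
        rw [this, mul_zero]
      rw [← zero_add (_ * _), ← h2, Finset.mul_sum, ← Finset.sum_add_distrib, RingOfIntegers.coe_eq_algebraMap, map_sum, map_sum]
      refine Finset.sum_congr rfl fun i _ => ?_
      have h3 : (m i : v.1.adicCompletion F) = algebraMap ℚ_[p] _ (a i / a i₀) +
          (p : v.1.adicCompletion F) * algebraMap ℚ_[p] _ (c i) := by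
        have := congrArg (algebraMap ℚ_[p] (v.1.adicCompletion F)) (hm i)
        simpa only [map_intCast, map_add, map_mul, map_natCast] using this
      rw [zsmul_eq_mul, map_mul, map_mul, map_intCast, map_intCast, h3, integralBasis_apply]
      ring
    rw [h1, norm_mul]
    refine mul_le_of_le_one_right (norm_nonneg _) ?_
    refine IsUltrametricDist.norm_sum_le_of_forall_le_of_nonneg zero_le_one fun i _ => ?_
    rw [norm_mul, integralBasis_apply]
    exact mul_le_one₀ (norm_algebraMap_padic_le v _ (hc i)) (norm_nonneg _)
      (FinitePlace.norm_le_one F v.1 _))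
  have h4 : m i₀ = p * B.repr y i₀ := by
    have h5 := congrArg (fun z => B.repr z i₀) hy
    simp only [← nsmul_eq_mul] at h5
    rw [B.repr_sum_self, map_nsmul] at h5
    simpa using h5
  have h6 := hm i₀
  rw [div_self h0, h4] at h6
  have h7 : (1 : ℚ_[p]) = p * ((B.repr y i₀ : ℤ) - c i₀) := by
    push_cast at h6
    linear_combination -h6
  have h8 := congrArg norm h7
  rw [norm_one, norm_mul] at h8
  have h9 : ‖((B.repr y i₀ : ℤ) : ℚ_[p]) - c i₀‖ ≤ 1 :=
    by
    rw [sub_eq_add_neg]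
    exact (Padic.nonarchimedean _ _).trans
      (max_le (Padic.norm_int_le_one _) ((norm_neg _).trans_le (hc i₀)))
  have h10 : ‖(p : ℚ_[p])‖ < 1 := Padic.norm_p_lt_one
  nlinarith [norm_nonneg (p : ℚ_[p]), norm_nonneg (((B.repr y i₀ : ℤ) : ℚ_[p]) - c i₀)]

instance : FiniteDimensional ℚ_[p] (LocalAlgebra F p) :=
  ⟨⟨(Set.finite_range _).toFinset, by
    rw [Set.Finite.coe_toFinset]; exact span_localEmbedding (integralBasis F)⟩⟩

lemma finrank_localAlgebra :
    Module.finrank ℚ_[p] (LocalAlgebra F p) = Module.finrank ℚ F := by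
  rw [Module.finrank_eq_card_basis (integralBasis F)]
  exact Module.finrank_eq_card_basis
    (Module.Basis.mk linearIndependent_integralBasis (span_localEmbedding (integralBasis F)).ge)

instance (v : PlaceAbove F p) : FiniteDimensional ℚ_[p] (v.1.adicCompletion F) :=
  Module.Finite.of_surjective (LinearMap.proj v : LocalAlgebra F p →ₗ[ℚ_[p]] v.1.adicCompletion F)
    (LinearMap.proj_surjective v)

lemma linearIndependent_localEmbedding {n : ℕ} (w : Module.Basis (Fin n) ℚ F) :
    LinearIndependent ℚ_[p] (fun i => localEmbedding p (w i)) := by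
  apply linearIndependent_of_top_le_span_of_card_eq_finrank (span_localEmbedding w).ge
  rw [finrank_localAlgebra, Module.finrank_eq_card_basis w]


/-- The local degree `n_v = [F_v : ℚ_p]`. -/
noncomputable def localDegree (v : PlaceAbove F p) : ℕ :=
  Module.finrank ℚ_[p] (v.1.adicCompletion F)

variable (F p) in
/-- The choices made at a prime `p`: for each `v ∣ p` an isomorphism `𝒪_v ≃ ℤ_p^{n_v}` of
`ℤ_p`-modules, given through its `ℚ_p`-linear extension `F_v ≃ ℚ_p^{n_v}`, that is, a `ℚ_p`-linear
isomorphism which carries `𝒪_v` onto `ℤ_p^{n_v}`; and an order of the resulting `∑ n_v = n`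
coordinates of `∏_{v ∣ p} F_v`. Such choices always exist, see `nonempty_padicFrame`. -/
structure PadicFrame (n : ℕ) where
  iso : ∀ v : PlaceAbove F p, v.1.adicCompletion F ≃ₗ[ℚ_[p]] (Fin (localDegree v) → ℚ_[p])
  mem_integers_iff : ∀ (v : PlaceAbove F p) (x : v.1.adicCompletion F),
    x ∈ v.1.adicCompletionIntegers F ↔ ∀ k, ‖iso v x k‖ ≤ 1
  order : (Σ v : PlaceAbove F p, Fin (localDegree v)) ≃ Fin n

lemma exists_integral_iso (v : PlaceAbove F p) :
    ∃ φ : v.1.adicCompletion F ≃ₗ[ℚ_[p]] (Fin (localDegree v) → ℚ_[p]),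
      ∀ x, x ∈ v.1.adicCompletionIntegers F ↔ ∀ k, ‖φ x k‖ ≤ 1 := by
  let E := v.1.adicCompletion F
  let _ : Algebra ℤ_[p] E := ((algebraMap ℚ_[p] E).comp (algebraMap ℤ_[p] ℚ_[p])).toAlgebra
  have : IsScalarTower ℤ_[p] ℚ_[p] E := IsScalarTower.of_algebraMap_eq fun _ => rfl
  have hsm : ∀ (a : ℤ_[p]) (x : E), a • x = (a : ℚ_[p]) • x := fun a x => by
    rw [← algebraMap_smul ℚ_[p] a x]; rfl
  let O : Submodule ℤ_[p] E :=
    { carrier := {x | ‖x‖ ≤ 1}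
      add_mem' := fun {a b} ha hb => (IsUltrametricDist.norm_add_le_max a b).trans (max_le ha hb)
      zero_mem' := by simp
      smul_mem' := fun a x hx => by
        change ‖a • x‖ ≤ 1
        rw [hsm, Algebra.smul_def, norm_mul]
        exact mul_le_one₀ (norm_algebraMap_padic_le v _ a.2) (norm_nonneg _) hx }
  have hp0 : (p : ℚ_[p]) ≠ 0 := by exact_mod_cast hp.out.ne_zero
  have hpE : (p : E) ≠ 0 := by
    rw [← map_natCast (algebraMap ℚ_[p] E)]
    exact (map_ne_zero _).2 hp0
  let β := Module.finBasis ℚ_[p] E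
  -- the coordinates of integers are bounded
  have hbd : ∃ k : ℕ, ∀ x ∈ O, ∀ i, ‖β.repr x i * (p : ℚ_[p]) ^ k‖ ≤ 1 := by
    have hcont : Continuous β.equivFun := LinearMap.continuous_of_finiteDimensional
      β.equivFun.toLinearMap
    obtain ⟨δ, hδ, h⟩ := Metric.continuousAt_iff.1 (hcont.continuousAt (x := (0 : E))) 1 one_pos
    obtain ⟨k, hk⟩ := exists_pow_lt_of_lt_one hδ (norm_p_lt_one v)
    refine ⟨k, fun x hx i => ?_⟩
    have h1 : dist ((p : E) ^ k * x) 0 < δ := by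
      rw [dist_zero_right, norm_mul, norm_pow]
      exact (mul_le_of_le_one_right (by positivity) hx).trans_lt hk
    have h2 := h h1
    rw [map_zero, dist_zero_right] at h2
    have h3 := (norm_le_pi_norm _ i).trans h2.le
    have h4 : (p : E) ^ k * x = ((p : ℚ_[p]) ^ k) • x := by
      rw [Algebra.smul_def, map_pow, map_natCast]
    rw [h4, map_smul] at h3
    rw [mul_comm]
    exact h3
  obtain ⟨k, hk⟩ := hbd
  have hle : O ≤ Submodule.span ℤ_[p] (Set.range fun i => ((p : ℚ_[p]) ^ k)⁻¹ • β i) := by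
    intro x hx
    rw [← β.sum_repr x]
    refine Submodule.sum_mem _ fun i _ => ?_
    let z : ℤ_[p] := ⟨β.repr x i * (p : ℚ_[p]) ^ k, hk x hx i⟩
    have : β.repr x i • β i = z •
        (((p : ℚ_[p]) ^ k)⁻¹ • β i) := by
      rw [hsm, smul_smul]
      congr 1
      change β.repr x i = β.repr x i * (p : ℚ_[p]) ^ k * ((p : ℚ_[p]) ^ k)⁻¹
      rw [mul_inv_cancel_right₀ (pow_ne_zero _ hp0)]
    rw [this]
    exact Submodule.smul_mem _ _ (Submodule.subset_span ⟨i, rfl⟩)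
  have : Module.Finite ℤ_[p] O := by
    have hfg : (Submodule.span ℤ_[p] (Set.range fun i => ((p : ℚ_[p]) ^ k)⁻¹ • β i)).FG :=
      Submodule.fg_span (Set.finite_range _)
    have := isNoetherian_of_fg_of_noetherian _ hfg
    exact Module.Finite.iff_fg.2 (Submodule.FG.of_le hfg hle)
  have : Module.IsTorsionFree ℤ_[p] E := Module.IsTorsionFree.trans_faithfulSMul ℤ_[p] ℚ_[p] E
  let b := Module.Free.chooseBasis ℤ_[p] O
  have hli : LinearIndependent ℚ_[p] (fun i => (b i : E)) := by
    rw [← LinearIndependent.iff_fractionRing ℤ_[p] ℚ_[p]]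
    exact b.linearIndependent.map' O.subtype O.ker_subtype
  have hsp : ⊤ ≤ Submodule.span ℚ_[p] (Set.range fun i => (b i : E)) := by
    intro x _
    obtain ⟨m, hm⟩ : ∃ m : ℕ, (p : E) ^ m * x ∈ O := by
      have h0 : Filter.Tendsto (fun m : ℕ => ‖(p : E)‖ ^ m * ‖x‖) Filter.atTop (nhds (0 * ‖x‖)) :=
        (tendsto_pow_atTop_nhds_zero_of_lt_one (norm_nonneg _) (norm_p_lt_one v)).mul_const _
      rw [zero_mul] at h0
      obtain ⟨m, hm⟩ := (h0.eventually (Iio_mem_nhds one_pos)).exists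
      refine ⟨m, ?_⟩
      change ‖_‖ ≤ 1
      rw [norm_mul, norm_pow]
      exact le_of_lt hm
    have h1 : (p : E) ^ m * x = ∑ i, b.repr ⟨_, hm⟩ i • (b i : E) := by
      have := congrArg O.subtype (b.sum_repr ⟨_, hm⟩)
      rw [map_sum] at this
      simp only [map_smul, Submodule.subtype_apply] at this
      exact this.symm
    have h2 : x = ((p : ℚ_[p]) ^ m)⁻¹ • ((p : E) ^ m * x) := by
      rw [Algebra.smul_def, map_inv₀, map_pow, map_natCast,
        inv_mul_cancel_left₀ (pow_ne_zero _ hpE)]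
    rw [h2, h1]
    refine Submodule.smul_mem _ _ (Submodule.sum_mem _ fun i _ => ?_)
    rw [hsm]
    exact Submodule.smul_mem _ _ (Submodule.subset_span ⟨i, rfl⟩)
  let b' := Module.Basis.mk hli hsp
  have hcard : Fintype.card (Module.Free.ChooseBasisIndex ℤ_[p] O) = localDegree v :=
    (Module.finrank_eq_card_basis b').symm
  let ε := Fintype.equivFinOfCardEq hcard
  let b'' := b'.reindex ε
  have hb'' : ∀ i, (b'' i : E) = b (ε.symm i) := fun i => by
    simp [b'', b']
  refine ⟨b''.equivFun, fun x => ?_⟩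
  rw [← norm_le_one_iff_mem]
  constructor
  · intro hx
    have h1 : x = ∑ i, ((b.repr ⟨x, hx⟩ (ε.symm i) : ℤ_[p]) : ℚ_[p]) • b'' i := by
      have h2 : x = ∑ i, b.repr ⟨x, hx⟩ i • (b i : E) := by
        have := congrArg O.subtype (b.sum_repr ⟨x, hx⟩)
        rw [map_sum] at this
        simp only [map_smul, Submodule.subtype_apply] at this
        exact this.symm
      rw [← ε.symm.sum_comp] at h2
      simpa only [hsm, hb''] using h2
    intro k
    have h3 : b''.equivFun x k = (b.repr ⟨x, hx⟩ (ε.symm k) : ℤ_[p]) := by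
      conv_lhs => rw [h1]
      rw [b''.equivFun_apply, b''.repr_sum_self]
    rw [h3]
    exact (b.repr ⟨x, hx⟩ (ε.symm k)).2
  · intro h
    change x ∈ O
    rw [← b''.sum_equivFun x]
    refine O.sum_mem fun i _ => ?_
    let z : ℤ_[p] := ⟨b''.equivFun x i, h i⟩
    have : b''.equivFun x i • b'' i = z • (b (ε.symm i) : E) := by
      rw [hsm, hb'']
    rw [this]
    exact O.smul_mem _ (b _).2

lemma nonempty_padicFrame {n : ℕ} (hn : Module.finrank ℚ F = n) : Nonempty (PadicFrame F p n) := by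
  choose φ hφ using exists_integral_iso (F := F) (p := p)
  refine ⟨⟨φ, hφ, Fintype.equivFinOfCardEq ?_⟩⟩
  rw [← hn, ← finrank_localAlgebra (p := p), Fintype.card_sigma, Module.finrank_pi_fintype]
  exact Finset.sum_congr rfl fun v _ => Fintype.card_fin _


lemma isUnit_det_scaled {K V : Type*} [Field K] [AddCommGroup V] [Module K V] {n : ℕ}
    (φ : V ≃ₗ[K] (Fin n → K)) (x : Fin n → V) (hx : LinearIndependent K x)
    (c : Fin n → K) (hc : ∀ j, c j ≠ 0) :
    IsUnit (Matrix.of fun i j => c j * φ (x i) j).det := by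
  have h1 : IsUnit (Matrix.of fun i j => φ (x i) j) := by
    rw [← Matrix.linearIndependent_rows_iff_isUnit]
    exact hx.map' φ.toLinearMap φ.ker
  have h2 : (Matrix.of fun i j => c j * φ (x i) j) =
      (Matrix.of fun i j => φ (x i) j) * Matrix.diagonal c := by
    ext i j
    simp [Matrix.mul_diagonal, mul_comm]
  rw [h2, Matrix.det_mul, Matrix.det_diagonal]
  exact ((Matrix.isUnit_iff_isUnit_det _).1 h1).mul
    (isUnit_iff_ne_zero.2 (Finset.prod_ne_zero_iff.2 fun j _ => hc j))

variable {n : ℕ}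

/-! ### The archimedean part -/

/-- The archimedean place to which a real coordinate of `F_∞ = ℝ^{r₁} × ℂ^{r₂}` belongs. -/
def placeOfIndex : mixedEmbedding.index F → InfinitePlace F
  | Sum.inl v => v.1
  | Sum.inr vk => vk.1.1

/-- The matrix `(t₁ w⁽¹⁾ ⋯ t_r w⁽ʳ⁾)`: its `i`-th row consists of the real coordinates of
`(t_v σ_v(w_i))_v ∈ F_∞ = ℝ^{r₁} × ℂ^{r₂} ≃ ℝ^n`, where a complex number has the two coordinates
`re` and `im` and `o` fixes the order in which the `n` coordinates are listed (so `(im, re)` at a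
complex place is allowed, and every order of the places). -/
noncomputable def archMatrix (w : Module.Basis (Fin n) ℚ F) (o : mixedEmbedding.index F ≃ Fin n)
    (t : InfinitePlace F → {x : ℝ // 0 < x}) : Matrix (Fin n) (Fin n) ℝ :=
  Matrix.of fun i j => (t (placeOfIndex (o.symm j)) : ℝ) *
    (mixedEmbedding.stdBasis F).repr (mixedEmbedding F (w i)) (o.symm j)

lemma linearIndependent_mixedEmbedding (w : Module.Basis (Fin n) ℚ F) :
    LinearIndependent ℝ (fun i => mixedEmbedding F (w i)) := by
  apply linearIndependent_of_top_le_span_of_card_eq_finrank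
  · rw [← (mixedEmbedding.latticeBasis F).span_eq, Submodule.span_le]
    rintro _ ⟨i, rfl⟩
    rw [mixedEmbedding.latticeBasis_apply, ← w.sum_repr (integralBasis F i), map_sum]
    refine Submodule.sum_mem _ fun j _ => ?_
    have : mixedEmbedding F (w.repr (integralBasis F i) j • w j) =
        ((w.repr (integralBasis F i) j : ℚ) : ℝ) • mixedEmbedding F (w j) := by
      rw [map_rat_smul (mixedEmbedding F), Rat.cast_smul_eq_qsmul]
    rw [this]
    exact Submodule.smul_mem _ _ (Submodule.subset_span ⟨j, rfl⟩)
  · rw [mixedEmbedding.finrank, Module.finrank_eq_card_basis w]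

lemma isUnit_det_archMatrix (w : Module.Basis (Fin n) ℚ F) (o : mixedEmbedding.index F ≃ Fin n)
    (t : InfinitePlace F → {x : ℝ // 0 < x}) : IsUnit (archMatrix w o t).det :=
  isUnit_det_scaled
    ((mixedEmbedding.stdBasis F).equivFun ≪≫ₗ LinearEquiv.funCongrLeft ℝ ℝ o.symm) _
    (linearIndependent_mixedEmbedding w) (fun j => (t (placeOfIndex (o.symm j)) : ℝ))
    fun _ => (t _).2.ne'

lemma nonempty_archOrder (hn : Module.finrank ℚ F = n) :
    Nonempty (mixedEmbedding.index F ≃ Fin n) := by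
  refine ⟨Finite.equivFinOfCardEq ?_⟩
  rw [← hn, ← mixedEmbedding.finrank,
    Module.finrank_eq_nat_card_basis (mixedEmbedding.stdBasis F)]

/-! ### The `p`-adic part -/

variable (p) in
/-- The discrete group `p^ℤ`, as a subgroup of `ℚˣ`. -/
def primePowers : Subgroup ℚˣ :=
  Subgroup.zpowers (Units.mk0 (p : ℚ) (Nat.cast_ne_zero.2 hp.out.ne_zero))

/-- The matrix `(p^{e₁} t₁⁻¹ v₁(w) ⋯ p^{e_g} t_g⁻¹ v_g(w))`: its `i`-th row consists of the
coordinates of `(p^{e_v} t_v⁻¹ v(w_i))_v ∈ ∏_{v ∣ p} F_v ≃ ℚ_p^n`. -/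
noncomputable def padicMatrix (w : Module.Basis (Fin n) ℚ F) (c : PadicFrame F p n)
    (e : PlaceAbove F p → ℤ) (t : PlaceAbove F p → primePowers p) : Matrix (Fin n) (Fin n) ℚ_[p] :=
  Matrix.of fun i j =>
    ((p : ℚ_[p]) ^ e (c.order.symm j).1 * (((t (c.order.symm j).1 : ℚˣ) : ℚ) : ℚ_[p])⁻¹) *
      c.iso (c.order.symm j).1 (algebraMap F _ (w i)) (c.order.symm j).2

lemma isUnit_det_padicMatrix (w : Module.Basis (Fin n) ℚ F) (c : PadicFrame F p n)
    (e : PlaceAbove F p → ℤ) (t : PlaceAbove F p → primePowers p) :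
    IsUnit (padicMatrix w c e t).det :=
  isUnit_det_scaled
    (LinearEquiv.piCongrRight c.iso ≪≫ₗ
      (LinearEquiv.piCurry ℚ_[p] fun (v : PlaceAbove F p) (_ : Fin (localDegree v)) => ℚ_[p]).symm ≪≫ₗ
      LinearEquiv.funCongrLeft ℚ_[p] ℚ_[p] c.order.symm) _
    (linearIndependent_localEmbedding w)
    (fun j => (p : ℚ_[p]) ^ e (c.order.symm j).1 *
      (((t (c.order.symm j).1 : ℚˣ) : ℚ) : ℚ_[p])⁻¹)
    fun _ => mul_ne_zero (zpow_ne_zero _ (Nat.cast_ne_zero.2 hp.out.ne_zero))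
      (inv_ne_zero (Rat.cast_ne_zero.2 (Units.ne_zero _)))

end

/-! ### The generalized upper half space -/

section
variable (n : ℕ)

/-- The finite places of `ℚ`. -/
abbrev RatPrime : Type := {p : ℕ // p.Prime}

instance (p : RatPrime) : Fact p.1.Prime := ⟨p.2⟩

/-- `O(n)` as a subgroup of `GL_n(ℝ)`. -/
def orthogonalSubgroup : Subgroup (GL (Fin n) ℝ) :=
  (Unitary.toUnits (R := Matrix (Fin n) (Fin n) ℝ)).range

/-- `GL_n(ℤ_p)` as a subgroup of `GL_n(ℚ_p)`. -/
noncomputable def padicIntegralSubgroup (p : ℕ) [Fact p.Prime] : Subgroup (GL (Fin n) ℚ_[p]) :=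
  (Matrix.GeneralLinearGroup.map (n := Fin n) (algebraMap ℤ_[p] ℚ_[p])).range

/-- `𝔥^n_∞ = GL_n(ℝ) / ℝˣ O(n)`, with the quotient topology. -/
abbrev ArchSpace : Type :=
  GL (Fin n) ℝ ⧸ ((Matrix.GeneralLinearGroup.scalar (Fin n) (R := ℝ)).range ⊔ orthogonalSubgroup n)

/-- `𝔥^n_p = GL_n(ℚ_p) / ℚ_pˣ GL_n(ℤ_p)`, with the quotient topology. -/
abbrev PadicSpace (p : ℕ) [Fact p.Prime] : Type :=
  GL (Fin n) ℚ_[p] ⧸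
    ((Matrix.GeneralLinearGroup.scalar (Fin n) (R := ℚ_[p])).range ⊔ padicIntegralSubgroup n p)

variable (S : Finset RatPrime)

/-- The generalized `S`-upper half space `𝔥^n_S = 𝔥^n_∞ × ∏_{p ∈ S} 𝔥^n_p`. Here and below, `S` is
the set of *finite* places; the archimedean place is always included. -/
def HSpace : Type := ArchSpace n × ∀ p : S, PadicSpace n p.1.1

noncomputable instance : TopologicalSpace (HSpace n S) :=
  inferInstanceAs (TopologicalSpace (ArchSpace n × ∀ p : S, PadicSpace n p.1.1))

/-- The subring `ℤ[1/N]` of `ℚ`, where `N = ∏_{p ∈ S} p`. -/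
def invertedIntegers : Subalgebra ℤ ℚ :=
  Algebra.adjoin ℤ {((∏ p ∈ S, p.1 : ℕ) : ℚ)⁻¹}

/-- `Γ_S = SL_n(ℤ[1/N])`. -/
abbrev Gamma : Type := Matrix.SpecialLinearGroup (Fin n) (invertedIntegers S)

/-- The homomorphism `Γ_S → GL_n(K)` for a field `K` of characteristic zero. -/
def gammaToGL (K : Type*) [Field K] [CharZero K] : Gamma n S →* GL (Fin n) K :=
  Matrix.SpecialLinearGroup.toGL.comp
    (Matrix.SpecialLinearGroup.map ((algebraMap ℚ K).comp (invertedIntegers S).val.toRingHom))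

/-- The diagonal left action of `Γ_S` on `𝔥^n_S`. -/
noncomputable instance : MulAction (Gamma n S) (HSpace n S) where
  smul A x := (gammaToGL n S ℝ A • x.1, fun p => gammaToGL n S ℚ_[p.1.1] A • x.2 p)
  one_smul x := by
    refine Prod.ext ?_ (funext fun p => ?_)
    · change gammaToGL n S ℝ 1 • x.1 = x.1
      rw [map_one, one_smul]
    · change gammaToGL n S ℚ_[p.1.1] 1 • x.2 p = x.2 p
      rw [map_one, one_smul]
  mul_smul A B x := by
    refine Prod.ext ?_ (funext fun p => ?_)
    · change gammaToGL n S ℝ (A * B) • x.1 = gammaToGL n S ℝ A • gammaToGL n S ℝ B • x.1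
      rw [map_mul, mul_smul]
    · change gammaToGL n S ℚ_[p.1.1] (A * B) • x.2 p =
        gammaToGL n S ℚ_[p.1.1] A • gammaToGL n S ℚ_[p.1.1] B • x.2 p
      rw [map_mul, mul_smul]

end

/-! ### Heegner objects and periods -/

section
variable (F : Type*) [Field F] [NumberField F] {n : ℕ} (S : Finset RatPrime)

/-- Every prime in `S` is unramified in `F/ℚ`. -/
abbrev IsUnramifiedIn : Prop :=
  ∀ p ∈ S, ∀ v : PlaceAbove F p.1, Algebra.IsUnramifiedAt ℤ v.1.asIdeal

/-- `∏_{v ∣ ∞} ℝ_{>0} × ∏_{p ∈ S} ∏_{v ∣ p} p^ℤ`. -/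
abbrev Torus : Type _ :=
  (InfinitePlace F → {x : ℝ // 0 < x}) × ∀ p : S, PlaceAbove F p.1.1 → primePowers p.1.1

/-- `T_S^1`: the families with `∏_{v ∣ ∞} t_v^{n_v} = 1` and `∏_{v ∣ p} t_v^{n_v} = 1` for every
`p ∈ S`. -/
def normOneTorus : Subgroup (Torus F S) where
  carrier := {t | ∏ v, t.1 v ^ v.mult = 1 ∧ ∀ p, ∏ v, t.2 p v ^ localDegree v = 1}
  one_mem' := by simp
  mul_mem' := by
    rintro a b ⟨ha, ha'⟩ ⟨hb, hb'⟩
    refine ⟨?_, fun p => ?_⟩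
    · simp only [Prod.fst_mul, Pi.mul_apply, mul_pow, Finset.prod_mul_distrib, ha, hb, mul_one]
    · simp only [Prod.snd_mul, Pi.mul_apply, mul_pow, Finset.prod_mul_distrib, ha' p, hb' p, mul_one]
  inv_mem' := by
    rintro a ⟨ha, ha'⟩
    refine ⟨?_, fun p => ?_⟩
    · simp only [Prod.fst_inv, Pi.inv_apply, inv_pow, Finset.prod_inv_distrib, ha, inv_one]
    · simp only [Prod.snd_inv, Pi.inv_apply, inv_pow, Finset.prod_inv_distrib, ha' p, inv_one]

variable {F S}

/-- The `S`-Heegner object `ϖ_S : T_S^1 → 𝔥^n_S` of the basis `w` with indices `e`. -/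
noncomputable def heegnerObject (w : Module.Basis (Fin n) ℚ F) (o : mixedEmbedding.index F ≃ Fin n)
    (c : ∀ p : S, PadicFrame F p.1.1 n) (e : ∀ p : S, PlaceAbove F p.1.1 → ℤ)
    (t : normOneTorus F S) : HSpace n S :=
  (QuotientGroup.mk (Matrix.GeneralLinearGroup.mk'' _ (isUnit_det_archMatrix w o t.1.1)),
    fun p => QuotientGroup.mk
      (Matrix.GeneralLinearGroup.mk'' _ (isUnit_det_padicMatrix w (c p) (e p) (t.1.2 p))))

/-- `(A, ρ)` is a period of `ϖ`: `A ϖ(t) = ϖ(ρ t)` for all `t`. -/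
def IsPeriod (ϖ : normOneTorus F S → HSpace n S) (A : Gamma n S) (ρ : normOneTorus F S) : Prop :=
  ∀ t, A • ϖ t = ϖ (ρ * t)

/-- The group `Λ_ϖ ⊂ T_S^1` of periods of `ϖ`. -/
def periodLattice (ϖ : normOneTorus F S → HSpace n S) : Subgroup (normOneTorus F S) where
  carrier := {ρ | ∃ A : Gamma n S, IsPeriod ϖ A ρ}
  one_mem' := ⟨1, fun t => by rw [one_smul, one_mul]⟩
  mul_mem' := by
    rintro ρ ρ' ⟨A, hA⟩ ⟨A', hA'⟩
    exact ⟨A * A', fun t => by rw [mul_smul, hA', hA, mul_assoc]⟩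
  inv_mem' := by
    rintro ρ ⟨A, hA⟩
    exact ⟨A⁻¹, fun t => by rw [inv_smul_eq_iff, hA, mul_inv_cancel_left]⟩

/-- `Γ_S \ 𝔥^n_S`, with the quotient topology. -/
abbrev GammaQuotient (n : ℕ) (S : Finset RatPrime) : Type :=
  Quotient (MulAction.orbitRel (Gamma n S) (HSpace n S))

end

end Heegner

namespace Heegner

/-! ### Primes above `p`: unramifiedness and residue degrees -/

section Places
variable {F : Type*} [Field F] [NumberField F] {p : ℕ} [hp : Fact p.Prime]

/-! Periods come from `S`-units. Multiplication by `x` on `F`, written in the basis `w`, is a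
rational matrix that turns the coordinate matrix of `w` into that of `x w` at every place at once.
If `x` preserves the `ℤ[1/N]`-lattice spanned by `w` and has norm 1, this matrix lies in `Γ_S`. At
an archimedean place `x` differs from its absolute value by a factor of modulus 1, which acts
orthogonally; above `p` it differs from the matching power of `p` by a unit of `𝒪_v`, which acts
through `GL_n(ℤ_p)`. Hence the absolute values of `x` form a period
(`mem_periodLattice_of_mem_multiplierRing`).

It remains to find enough such `x`. The lattice need not be stable under `𝓞 F`, but a fixed power of
every `S`-unit dividing a power of `N`, and of its inverse, preserves it
(`exists_pow_mem_multiplierRing`). Units then give periods with trivial finite part whose logarithms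
form a full lattice, by Dirichlet's theorem (`exists_pow_unit_mem_periodLattice`). Generators of the
principal ideals `v ^ h`, with `h` the class number, realize a fixed power of every norm-one finite
part (`exists_pow_eq_of_mem_periodLattice`); unramifiedness makes `p` a uniformizer at `v` and the
residue degree equal to `n_v`, so that the local condition `∏ t_v ^ n_v = 1` becomes norm `±1`.

The finite parts form a finitely generated group, so finitely many represent them modulo that power.
Finitely many copies of a closed ball in logarithmic space therefore meet every coset of the period
lattice (`exists_isCompact_mul_periodLattice`). The image in the `Γ_S`-quotient is compact because
translating by a period stays in one `Γ_S`-orbit. -/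

lemma norm_algebraMap_le_one_iff (v : HeightOneSpectrum (𝓞 F)) (x : F) :
    ‖algebraMap F (v.adicCompletion F) x‖ ≤ 1 ↔ v.valuation F x ≤ 1 := by
  rw [norm_le_one_iff_mem, HeightOneSpectrum.mem_adicCompletionIntegers,
    ← HeightOneSpectrum.valuedAdicCompletion_eq_valuation' v]
  rfl

lemma norm_algebraMap_eq_one_iff (v : HeightOneSpectrum (𝓞 F)) (x : F) :
    ‖algebraMap F (v.adicCompletion F) x‖ = 1 ↔ v.valuation F x = 1 := by
  rcases eq_or_ne x 0 with rfl | hx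
  · simp
  have h1 := norm_algebraMap_le_one_iff v x
  have h2 := norm_algebraMap_le_one_iff v x⁻¹
  have h3 : 0 < v.valuation F x := by simpa [zero_lt_iff] using hx
  have h4 : 0 < ‖algebraMap F (v.adicCompletion F) x‖ := by simpa using hx
  rw [map_inv₀, map_inv₀, norm_inv, inv_le_one₀ h3, inv_le_one₀ h4] at h2
  rw [le_antisymm_iff, le_antisymm_iff, h1, h2]

/-- Ramification index 1 excludes `p ∈ v ^ 2`; together with `p ∈ v` this fixes the exponent. All
uses of unramifiedness go through this lemma. -/
lemma valuation_natCast_of_isUnramifiedAt (v : PlaceAbove F p)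
    [Algebra.IsUnramifiedAt ℤ v.1.asIdeal] :
    v.1.valuation F (p : F) = WithZero.exp (-1 : ℤ) := by
  have hp0 : (p : 𝓞 F) ≠ 0 := by simp [hp.out.ne_zero]
  have hprime : (Ideal.span {(p : ℤ)}).IsPrime := by
    rw [Ideal.span_singleton_prime (by exact_mod_cast hp.out.ne_zero)]
    exact Nat.prime_iff_prime_int.1 hp.out
  have hmax : (Ideal.span {(p : ℤ)}).IsMaximal :=
    hprime.isMaximal (by simpa using hp.out.ne_zero)
  have hmap : (Ideal.span {(p : ℤ)}).map (algebraMap ℤ (𝓞 F)) = Ideal.span {(p : 𝓞 F)} := by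
    simp [Ideal.map_span]
  have hle : (Ideal.span {(p : ℤ)}).map (algebraMap ℤ (𝓞 F)) ≤ v.1.asIdeal := by
    rw [hmap, Ideal.span_singleton_le_iff_mem]
    exact v.2
  have : v.1.asIdeal.LiesOver (Ideal.span {(p : ℤ)}) :=
    ⟨hmax.eq_of_le (Ideal.IsPrime.under ℤ v.1.asIdeal).ne_top (Ideal.map_le_iff_le_comap.1 hle)⟩
  have h1 : Ideal.ramificationIdx' (Ideal.span {(p : ℤ)}) v.1.asIdeal = 1 := by
    rw [Ideal.ramificationIdx'_eq_ramificationIdx _ _ (by simpa using hp.out.ne_zero)]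
    exact Ideal.ramificationIdx_eq_one _ _
  have h2 : (p : 𝓞 F) ∉ v.1.asIdeal ^ 2 := by
    intro h
    refine (Ideal.ramificationIdx'_ne_one_iff hle).2 ?_ h1
    rwa [hmap, Ideal.span_singleton_le_iff_mem]
  have h3 := (v.1.intValuation_le_pow_iff_mem (p : 𝓞 F) 1).2 (by simpa using v.2)
  have h4 := (v.1.intValuation_le_pow_iff_mem (p : 𝓞 F) 2).not.2 h2
  have h5 : v.1.valuation F (p : F) = v.1.intValuation (p : 𝓞 F) := by
    rw [← v.1.valuation_of_algebraMap (K := F)]; simp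
  rw [h5]
  rw [v.1.intValuation_if_neg hp0] at h3 h4 ⊢
  rw [WithZero.exp_le_exp] at h3 h4
  rw [WithZero.exp_inj]
  push_cast at h3 h4
  lia

lemma norm_algebraMap_le_norm_natCast_iff (v : PlaceAbove F p)
    [Algebra.IsUnramifiedAt ℤ v.1.asIdeal] (x : 𝓞 F) :
    ‖algebraMap F (v.1.adicCompletion F) x‖ ≤ ‖(p : v.1.adicCompletion F)‖ ↔ x ∈ v.1.asIdeal := by
  have hp0 : (p : F) ≠ 0 := by simp [hp.out.ne_zero]
  have h0 : 0 < ‖(p : v.1.adicCompletion F)‖ := by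
    rw [← map_natCast (algebraMap F (v.1.adicCompletion F)), norm_pos_iff]
    exact (map_ne_zero _).2 hp0
  have h1 := norm_algebraMap_le_one_iff v.1 ((x : F) / p)
  rw [map_div₀, norm_div, map_natCast, div_le_one₀ h0, map_div₀,
    valuation_natCast_of_isUnramifiedAt v, div_le_one₀ (WithZero.exp_pos)] at h1
  rw [h1, v.1.valuation_of_algebraMap]
  simpa using v.1.intValuation_le_pow_iff_mem x 1

/-- Density of `F` in `F_v` gives a `v`-integral approximation, which is then approximated by a
global integer; the ultrametric inequality combines the two errors. -/
lemma exists_ringOfIntegers_sub_norm_le (v : PlaceAbove F p)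
    [Algebra.IsUnramifiedAt ℤ v.1.asIdeal] (y : v.1.adicCompletion F) (hy : ‖y‖ ≤ 1) :
    ∃ a : 𝓞 F, ‖algebraMap F (v.1.adicCompletion F) a - y‖ ≤ ‖(p : v.1.adicCompletion F)‖ := by
  have hp0 : (p : F) ≠ 0 := by simp [hp.out.ne_zero]
  have h0 : 0 < ‖(p : v.1.adicCompletion F)‖ := by
    rw [← map_natCast (algebraMap F (v.1.adicCompletion F)), norm_pos_iff]
    exact (map_ne_zero _).2 hp0
  obtain ⟨x, hx⟩ := Metric.denseRange_iff.1 (v.1.denseRange_algebraMap F) y _ h0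
  rw [dist_comm, dist_eq_norm] at hx
  have hx1 : ‖algebraMap F (v.1.adicCompletion F) x‖ ≤ 1 := by
    rw [← sub_add_cancel (algebraMap F (v.1.adicCompletion F) x) y]
    exact (IsUltrametricDist.norm_add_le_max _ _).trans
      (max_le (hx.le.trans (norm_p_lt_one v).le) hy)
  obtain ⟨a, ha⟩ := v.1.exists_valuation_sub_lt_of_integer
    ((norm_algebraMap_le_one_iff v.1 x).1 hx1) (Units.mk0 (WithZero.exp (-1 : ℤ)) (by simp))
  refine ⟨a, ?_⟩
  have h2 : ‖algebraMap F (v.1.adicCompletion F) ((a - x : F) / p)‖ ≤ 1 := by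
    rw [norm_algebraMap_le_one_iff, map_div₀, valuation_natCast_of_isUnramifiedAt v,
      div_le_one₀ WithZero.exp_pos]
    exact ha.le
  rw [map_div₀, norm_div, map_natCast, div_le_one₀ h0, map_sub] at h2
  rw [← sub_add_sub_cancel _ (algebraMap F (v.1.adicCompletion F) x) y]
  exact (IsUltrametricDist.norm_add_le_max _ _).trans (max_le h2 hx.le)

lemma PadicFrame.norm_le_norm_natCast_iff {n : ℕ} (c : PadicFrame F p n) (v : PlaceAbove F p)
    (x : v.1.adicCompletion F) :
    ‖x‖ ≤ ‖(p : v.1.adicCompletion F)‖ ↔ ∀ k, ‖c.iso v x k‖ < 1 := by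
  have hpp : (p : ℚ_[p]) ≠ 0 := by exact_mod_cast hp.out.ne_zero
  have hpv : (p : v.1.adicCompletion F) = algebraMap ℚ_[p] (v.1.adicCompletion F) p := by simp
  have h0 : 0 < ‖(p : v.1.adicCompletion F)‖ := by
    rw [hpv, norm_pos_iff]
    exact (map_ne_zero _).2 hpp
  have h1 : ‖x‖ ≤ ‖(p : v.1.adicCompletion F)‖ ↔ ‖(p : ℚ_[p])⁻¹ • x‖ ≤ 1 := by
    rw [Algebra.smul_def, map_inv₀, ← hpv, norm_mul, norm_inv, inv_mul_le_iff₀ h0, mul_one]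
  rw [h1, norm_le_one_iff_mem, c.mem_integers_iff]
  refine forall_congr' fun k => ?_
  have hp1 : (1 : ℝ) < p := by exact_mod_cast hp.out.one_lt
  rw [map_smul, Pi.smul_apply, smul_eq_mul, norm_mul, norm_inv, Padic.norm_p, inv_inv]
  -- The `p`-adic norm is discretely valued: at most `p⁻¹` is the same as less than `p⁰`.
  have h2 := Padic.norm_le_pow_iff_norm_lt_pow_add_one (c.iso v x k) (-1)
  rw [neg_add_cancel, zpow_zero, zpow_neg_one] at h2
  rw [← h2, mul_comm, ← le_div_iff₀ (by positivity), one_div]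

/-- Reducing the frame coordinates modulo `p` maps `𝓞 F` additively onto `𝔽_p ^ n_v`. The kernel is
`𝓞 F ∩ p 𝒪_v`, which is `v` itself because `p` is a uniformizer. -/
lemma absNorm_eq_pow_localDegree {n : ℕ} (c : PadicFrame F p n) (v : PlaceAbove F p)
    [Algebra.IsUnramifiedAt ℤ v.1.asIdeal] :
    Ideal.absNorm v.1.asIdeal = p ^ localDegree v := by
  have hint : ∀ (x : 𝓞 F) k, ‖c.iso v (algebraMap F _ x) k‖ ≤ 1 := fun x =>
    (c.mem_integers_iff v _).1 ((norm_le_one_iff_mem _ _).1 (FinitePlace.norm_le_one F v.1 x))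
  have hlift : ∀ (x : 𝓞 F) k, ∃ z : ℤ_[p], (z : ℚ_[p]) = c.iso v (algebraMap F _ x) k :=
    fun x k => ⟨⟨_, hint x k⟩, rfl⟩
  choose z hz using hlift
  let f : 𝓞 F →+ (Fin (localDegree v) → ZMod p) :=
    AddMonoidHom.mk' (fun x k => PadicInt.toZMod (z x k)) fun x y => by
      refine funext fun k => ?_
      have : z (x + y) k = z x k + z y k := by
        refine PadicInt.ext ?_
        push_cast
        simp [hz]
      rw [this, map_add]
      rfl
  have hf : ∀ x k, f x k = PadicInt.toZMod (z x k) := fun _ _ => rfl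
  have hzero : ∀ y : ℤ_[p], PadicInt.toZMod y = 0 ↔ ‖(y : ℚ_[p])‖ < 1 := fun y => by
    rw [← RingHom.mem_ker, PadicInt.ker_toZMod, IsLocalRing.mem_maximalIdeal,
      PadicInt.mem_nonunits, PadicInt.norm_def]
  have hker : ∀ x : 𝓞 F, f x = 0 ↔ x ∈ v.1.asIdeal := fun x => by
    rw [← norm_algebraMap_le_norm_natCast_iff, c.norm_le_norm_natCast_iff, funext_iff]
    refine forall_congr' fun k => ?_
    rw [hf, Pi.zero_apply, hzero, hz]
  have hsurj : Function.Surjective f := by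
    intro g
    choose y hy using fun k => ZMod.ringHom_surjective (PadicInt.toZMod (p := p)) (g k)
    obtain ⟨a, ha⟩ := exists_ringOfIntegers_sub_norm_le v
      ((c.iso v).symm fun k => (y k : ℚ_[p])) (by
        rw [norm_le_one_iff_mem, c.mem_integers_iff]
        intro k
        rw [LinearEquiv.apply_symm_apply]
        exact (y k).2)
    rw [c.norm_le_norm_natCast_iff] at ha
    refine ⟨a, funext fun k => ?_⟩
    rw [← hy k, hf, ← sub_eq_zero, ← map_sub, hzero, PadicInt.coe_sub, hz]
    have := ha k
    rwa [map_sub, LinearEquiv.apply_symm_apply] at this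
  have h1 : v.1.asIdeal.toAddSubgroup = f.ker := by
    ext x
    rw [AddMonoidHom.mem_ker, hker]
    rfl
  rw [Ideal.absNorm_apply, Submodule.cardQuot_apply]
  change v.1.asIdeal.toAddSubgroup.index = _
  rw [h1, AddSubgroup.index_ker, AddMonoidHom.range_eq_top.2 hsurj, AddSubgroup.card_top]
  simp

end Places

/-! ### Coordinate matrices and multiplication in the algebra -/

section Coordinates
variable {F : Type*} [Field F] [NumberField F] {n : ℕ}
  {K V : Type*} [Field K] [CharZero K] [CommRing V] [Algebra K V]

/-- The matrix whose `i`-th row consists of the coordinates of `y * ι (w i)`. -/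
noncomputable def coordMatrix (b : Module.Basis (Fin n) K V) (ι : F →+* V)
    (w : Module.Basis (Fin n) ℚ F) (y : V) : Matrix (Fin n) (Fin n) K :=
  Matrix.of fun i j => b.repr (y * ι (w i)) j

/-- Coordinates are rows here, so multiplication in `V` acts on the right by the transpose. -/
lemma coordMatrix_mul (b : Module.Basis (Fin n) K V) (ι : F →+* V)
    (w : Module.Basis (Fin n) ℚ F) (y z : V) :
    coordMatrix b ι w (y * z) = coordMatrix b ι w y * (Algebra.leftMulMatrix b z).transpose := by
  ext i j
  have := congrFun (Algebra.leftMulMatrix_mulVec_repr b z (y * ι (w i))) j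
  rw [Matrix.mulVec, dotProduct] at this
  simp only [coordMatrix, Matrix.of_apply, Matrix.mul_apply, Matrix.transpose_apply]
  rw [mul_comm y z, mul_assoc, ← this]
  exact Finset.sum_congr rfl fun _ _ => mul_comm _ _

/-- Acting on the left mixes the rows, hence the vectors `w i`, with the rational coefficients
expressing `x * w i` in `w`. The matrix does not depend on `V` or `y`, so one element of `Γ_S` can
work at all places and for all `t`. -/
lemma map_leftMulMatrix_mul_coordMatrix (b : Module.Basis (Fin n) K V) (ι : F →+* V)
    (w : Module.Basis (Fin n) ℚ F) (x : F) (y : V) :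
    (Algebra.leftMulMatrix w x).transpose.map (algebraMap ℚ K) * coordMatrix b ι w y =
      coordMatrix b ι w (y * ι x) := by
  ext i j
  have hι : ∀ (q : ℚ) (z : F), ι (q • z) = (q : K) • ι z := fun q z => by
    -- Ring homomorphisms out of `ℚ` are unique, so `ι` is automatically `ℚ`-linear.
    have h : ι.comp (algebraMap ℚ F) = (algebraMap K V).comp (algebraMap ℚ K) :=
      Subsingleton.elim _ _
    rw [Algebra.smul_def, Algebra.smul_def, map_mul]
    congr 1
    simpa using RingHom.congr_fun h q
  have h1 : y * ι x * ι (w i) = ∑ k, (w.repr (x * w i) k : K) • (y * ι (w k)) := by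
    rw [mul_assoc, ← map_mul]
    conv_lhs => rw [← w.sum_repr (x * w i), map_sum, Finset.mul_sum]
    exact Finset.sum_congr rfl fun k _ => by rw [hι, mul_smul_comm]
  simp only [coordMatrix, Matrix.of_apply, Matrix.mul_apply, Matrix.map_apply,
    Matrix.transpose_apply, Algebra.leftMulMatrix_eq_repr_mul]
  rw [h1, map_sum, Finsupp.finsetSum_apply]
  simp

end Coordinates

/-! ### Orthogonality at the archimedean places -/

section Archimedean
variable {F : Type*} [Field F] [NumberField F] {n : ℕ}

/-- The basis of `F_∞` underlying `archMatrix`. -/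
noncomputable def archBasis (o : mixedEmbedding.index F ≃ Fin n) :
    Module.Basis (Fin n) ℝ (mixedEmbedding.mixedSpace F) :=
  (mixedEmbedding.stdBasis F).reindex o

/-- A family indexed by the infinite places as an element of `F_∞`. -/
noncomputable def archScalar (t : InfinitePlace F → {x : ℝ // 0 < x}) :
    mixedEmbedding.mixedSpace F :=
  (fun v => (t v.1 : ℝ), fun v => ((t v.1 : ℝ) : ℂ))

lemma archScalar_mul (s t : InfinitePlace F → {x : ℝ // 0 < x}) :
    archScalar (s * t) = archScalar t * archScalar s := by
  refine Prod.ext (funext fun v => ?_) (funext fun v => ?_) <;>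
  simp [archScalar, mul_comm]

lemma archMatrix_eq_coordMatrix (w : Module.Basis (Fin n) ℚ F)
    (o : mixedEmbedding.index F ≃ Fin n) (t : InfinitePlace F → {x : ℝ // 0 < x}) :
    archMatrix w o t = coordMatrix (archBasis o) (mixedEmbedding F) w (archScalar t) := by
  ext i j
  simp only [archMatrix, coordMatrix, Matrix.of_apply, archBasis, Module.Basis.repr_reindex_apply]
  rcases o.symm j with v | ⟨v, k⟩
  · simp [placeOfIndex, archScalar]
  · fin_cases k <;> simp [placeOfIndex, archScalar]

open scoped Classical in
lemma sum_archBasis_repr_mul_repr (o : mixedEmbedding.index F ≃ Fin n)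
    (x y : mixedEmbedding.mixedSpace F) :
    ∑ k, (archBasis o).repr x k * (archBasis o).repr y k =
      ∑ v, x.1 v * y.1 v + ∑ v, ((x.2 v).re * (y.2 v).re + (x.2 v).im * (y.2 v).im) := by
  simp only [archBasis, Module.Basis.repr_reindex_apply]
  rw [o.symm.sum_comp fun k => (mixedEmbedding.stdBasis F).repr x k *
    (mixedEmbedding.stdBasis F).repr y k, Fintype.sum_sum_type, Fintype.sum_prod_type]
  simp

open scoped Classical in
-- The coordinate dot product is the sum of `x y` over real places and of `Re (x ȳ)` over complex
-- ones, so factors of modulus 1 preserve it.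
lemma leftMulMatrix_archBasis_mem_unitary (o : mixedEmbedding.index F ≃ Fin n)
    (u : mixedEmbedding.mixedSpace F) (h1 : ∀ v, ‖u.1 v‖ = 1) (h2 : ∀ v, ‖u.2 v‖ = 1) :
    (Algebra.leftMulMatrix (archBasis o) u).transpose ∈
      unitary (Matrix (Fin n) (Fin n) ℝ) := by
  have h : (Algebra.leftMulMatrix (archBasis o) u).transpose *
      Algebra.leftMulMatrix (archBasis o) u = 1 := by
    ext i j
    have key : ∀ y z : mixedEmbedding.mixedSpace F,
        ∑ k, (archBasis o).repr (u * y) k * (archBasis o).repr (u * z) k =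
          ∑ k, (archBasis o).repr y k * (archBasis o).repr z k := fun y z => by
      rw [sum_archBasis_repr_mul_repr, sum_archBasis_repr_mul_repr]
      congr 1
      · refine Finset.sum_congr rfl fun v _ => ?_
        have := h1 v
        rw [Real.norm_eq_abs, ← sq_eq_sq₀ (abs_nonneg _) zero_le_one, sq_abs] at this
        simp only [Prod.fst_mul, Pi.mul_apply]
        linear_combination (y.1 v * z.1 v) * this
      · refine Finset.sum_congr rfl fun v _ => ?_
        have := h2 v
        rw [← sq_eq_sq₀ (norm_nonneg _) zero_le_one, Complex.sq_norm, Complex.normSq_apply] at this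
        simp only [Prod.snd_mul, Pi.mul_apply, Complex.mul_re, Complex.mul_im]
        linear_combination ((y.2 v).re * (z.2 v).re + (y.2 v).im * (z.2 v).im) * this
    simp only [Matrix.mul_apply, Matrix.transpose_apply, Algebra.leftMulMatrix_eq_repr_mul]
    rw [key]
    simp [Finsupp.single_apply, Matrix.one_apply]
  rw [Unitary.mem_iff, Matrix.star_eq_conjTranspose, Matrix.conjTranspose_eq_transpose_of_trivial,
    Matrix.transpose_transpose]
  exact ⟨mul_eq_one_comm.1 h, h⟩

end Archimedean

/-! ### Integrality at the finite places -/

section Padic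
variable {F : Type*} [Field F] [NumberField F] {p : ℕ} [hp : Fact p.Prime] {n : ℕ}

/-- The basis of `∏_{v ∣ p} F_v` given by a frame. -/
noncomputable def PadicFrame.basis (c : PadicFrame F p n) :
    Module.Basis (Fin n) ℚ_[p] (LocalAlgebra F p) :=
  Module.Basis.ofEquivFun (LinearEquiv.piCongrRight c.iso ≪≫ₗ
      (LinearEquiv.piCurry ℚ_[p] fun (v : PlaceAbove F p) (_ : Fin (localDegree v)) => ℚ_[p]).symm ≪≫ₗ
      LinearEquiv.funCongrLeft ℚ_[p] ℚ_[p] c.order.symm)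

lemma PadicFrame.basis_repr (c : PadicFrame F p n) (y : LocalAlgebra F p) (j : Fin n) :
    c.basis.repr y j = c.iso (c.order.symm j).1 (y (c.order.symm j).1) (c.order.symm j).2 := rfl

lemma PadicFrame.norm_le_one_iff (c : PadicFrame F p n) (y : LocalAlgebra F p) :
    (∀ v, ‖y v‖ ≤ 1) ↔ ∀ j, ‖c.basis.repr y j‖ ≤ 1 := by
  simp only [norm_le_one_iff_mem, c.mem_integers_iff, c.basis_repr]
  refine ⟨fun h j => h _ _, fun h v k => ?_⟩
  have := h (c.order ⟨v, k⟩)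
  rwa [c.order.symm_apply_apply] at this

/-- The element of `∏_{v ∣ p} F_v` by which `padicMatrix` scales the basis. -/
noncomputable def padicScalar (e : PlaceAbove F p → ℤ) (t : PlaceAbove F p → primePowers p) :
    LocalAlgebra F p :=
  fun v => algebraMap ℚ_[p] (v.1.adicCompletion F)
    ((p : ℚ_[p]) ^ e v * (((t v : ℚˣ) : ℚ) : ℚ_[p])⁻¹)

lemma padicScalar_mul (e : PlaceAbove F p → ℤ) (s t : PlaceAbove F p → primePowers p) :
    padicScalar e (s * t) = padicScalar e t * padicScalar 0 s := by
  refine funext fun v => ?_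
  simp only [padicScalar, Pi.mul_apply, ← map_mul]
  congr 1
  push_cast
  simp
  ring

lemma padicMatrix_eq_coordMatrix (w : Module.Basis (Fin n) ℚ F) (c : PadicFrame F p n)
    (e : PlaceAbove F p → ℤ) (t : PlaceAbove F p → primePowers p) :
    padicMatrix w c e t = coordMatrix c.basis (localEmbedding p) w (padicScalar e t) := by
  ext i j
  simp only [padicMatrix, coordMatrix, Matrix.of_apply, c.basis_repr, Pi.mul_apply, padicScalar]
  rw [← Algebra.smul_def, map_smul]
  rfl

/-- Both `u` and its componentwise inverse preserve `∏ 𝒪_v`, which the frame identifies with `ℤ_p ^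
n`; their matrices are integral and mutually inverse. -/
lemma leftMulMatrix_basis_mem_padicIntegralSubgroup (c : PadicFrame F p n)
    (u : LocalAlgebra F p) (hu : ∀ v, ‖u v‖ = 1) :
    ∃ U ∈ padicIntegralSubgroup n p,
      (U : Matrix (Fin n) (Fin n) ℚ_[p]) = (Algebra.leftMulMatrix c.basis u).transpose := by
  have hint : ∀ u : LocalAlgebra F p, (∀ v, ‖u v‖ = 1) →
      ∃ X : Matrix (Fin n) (Fin n) ℤ_[p],
        X.map (algebraMap ℤ_[p] ℚ_[p]) = (Algebra.leftMulMatrix c.basis u).transpose := by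
    intro u hu
    have h : ∀ i j, ∃ z : ℤ_[p], algebraMap ℤ_[p] ℚ_[p] z =
        Algebra.leftMulMatrix c.basis u j i := fun i j => by
      refine ⟨⟨Algebra.leftMulMatrix c.basis u j i, ?_⟩, rfl⟩
      rw [Algebra.leftMulMatrix_eq_repr_mul]
      refine (c.norm_le_one_iff _).1 (fun v => ?_) j
      rw [Pi.mul_apply, norm_mul, hu, one_mul]
      refine (c.norm_le_one_iff _).2 (fun k => ?_) v
      rw [c.basis.repr_self, Finsupp.single_apply]
      split_ifs <;> simp
    choose X hX using h
    exact ⟨Matrix.of X, by ext i j; exact hX i j⟩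
  obtain ⟨X, hX⟩ := hint u hu
  obtain ⟨Y, hY⟩ := hint u⁻¹ fun v => by rw [Pi.inv_apply, norm_inv, hu, inv_one]
  have huu : u⁻¹ * u = 1 := funext fun v => by
    refine inv_mul_cancel₀ fun h => ?_
    have := hu v
    rw [h, norm_zero] at this
    exact zero_ne_one this
  have hXY : X * Y = 1 := by
    have hinj : Function.Injective ((algebraMap ℤ_[p] ℚ_[p]).mapMatrix (m := Fin n)) :=
      Matrix.map_injective (FaithfulSMul.algebraMap_injective _ _)
    apply hinj
    rw [map_mul, map_one, RingHom.mapMatrix_apply, RingHom.mapMatrix_apply, hX, hY,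
      ← Matrix.transpose_mul, ← map_mul, huu, map_one, Matrix.transpose_one]
  exact ⟨_, ⟨⟨X, Y, hXY, mul_eq_one_comm.1 hXY⟩, rfl⟩, hX⟩

end Padic

/-! ### From multipliers of norm one to periods -/

section Periods
variable {F : Type*} [Field F] [NumberField F] {n : ℕ} {S : Finset RatPrime}

/-- The ring of multipliers of the lattice spanned by `w` over `ℤ[1/N]`. -/
noncomputable def multiplierRing (w : Module.Basis (Fin n) ℚ F) (S : Finset RatPrime) : Subring F :=
  ((invertedIntegers S).toSubring.matrix).comap (Algebra.leftMulMatrix w).toRingHom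

lemma mem_multiplierRing {w : Module.Basis (Fin n) ℚ F} {x : F} :
    x ∈ multiplierRing w S ↔ ∀ i j, Algebra.leftMulMatrix w x i j ∈ invertedIntegers S := Iff.rfl

/-- The determinant of multiplication by `x` is its norm. -/
lemma exists_gamma_of_mem_multiplierRing {w : Module.Basis (Fin n) ℚ F} {x : F}
    (hx : x ∈ multiplierRing w S) (hN : Algebra.norm ℚ x = 1) :
    ∃ A : Gamma n S, ∀ (K : Type) [Field K] [CharZero K],
      (gammaToGL n S K A : Matrix (Fin n) (Fin n) K) =
        (Algebra.leftMulMatrix w x).transpose.map (algebraMap ℚ K) := by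
  let A₀ : Matrix (Fin n) (Fin n) (invertedIntegers S) :=
    Matrix.of fun i j => ⟨Algebra.leftMulMatrix w x j i, hx j i⟩
  have hA : (invertedIntegers S).val.toRingHom.mapMatrix A₀ =
      (Algebra.leftMulMatrix w x).transpose := rfl
  have hdet : A₀.det = 1 := by
    apply Subtype.val_injective
    change (invertedIntegers S).val.toRingHom A₀.det = 1
    rw [RingHom.map_det, hA, Matrix.det_transpose, ← Algebra.norm_eq_matrix_det, hN]
  exact ⟨⟨A₀, hdet⟩, fun K _ _ => rfl⟩

lemma mk_eq_of_coe_eq_mul {K : Type*} [Field K] (H : Subgroup (GL (Fin n) K))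
    (A g g' U : GL (Fin n) K) (hU : U ∈ H)
    (h : (g' : Matrix (Fin n) (Fin n) K) = (A : Matrix (Fin n) (Fin n) K) * g * U) :
    A • (QuotientGroup.mk g : GL (Fin n) K ⧸ H) = QuotientGroup.mk g' := by
  have : g' = A * g * U := Units.ext h
  rw [this, QuotientGroup.mk_mul_of_mem _ hU]
  rfl

/-- At each place the scaling by `ρ` equals `x` times some `u` of absolute value 1. The factor `x`
moves to the left as an element of `Γ_S`, and `u` is absorbed on the right by the compact subgroup.
In `hfin` the product `x ρ` appears, not a quotient, because the finite components are scaled by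
`t⁻¹`. -/
theorem mem_periodLattice_of_mem_multiplierRing (w : Module.Basis (Fin n) ℚ F)
    (o : mixedEmbedding.index F ≃ Fin n) (c : ∀ p : S, PadicFrame F p.1.1 n)
    (e : ∀ p : S, PlaceAbove F p.1.1 → ℤ) {x : F} (hx : x ∈ multiplierRing w S)
    (hN : Algebra.norm ℚ x = 1) (ρ : normOneTorus F S)
    (hinf : ∀ v, (ρ.1.1 v : ℝ) = v x)
    (hfin : ∀ (p : S) (v : PlaceAbove F p.1.1),
      v.1.valuation F (x * ((ρ.1.2 p v : ℚˣ) : ℚ)) = 1) :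
    ρ ∈ periodLattice (heegnerObject w o c e) := by
  have hx0 : x ≠ 0 := by
    rintro rfl
    simp at hN
  obtain ⟨A, hA⟩ := exists_gamma_of_mem_multiplierRing hx hN
  refine ⟨A, fun t => Prod.ext ?_ (funext fun p => ?_)⟩
  · obtain ⟨u, hu, hu1, hu2⟩ : ∃ u, mixedEmbedding F x * u = archScalar ρ.1.1 ∧
        (∀ v, ‖u.1 v‖ = 1) ∧ ∀ v, ‖u.2 v‖ = 1 := by
      have hr' : ∀ v, ‖(mixedEmbedding F x).1 v‖ = v.1 x := fun v =>
        InfinitePlace.norm_embedding_of_isReal v.2 x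
      have hc' : ∀ v, ‖(mixedEmbedding F x).2 v‖ = v.1 x := fun v =>
        InfinitePlace.norm_embedding_eq v.1 x
      have hr : ∀ v, (mixedEmbedding F x).1 v ≠ 0 := fun v =>
        norm_ne_zero_iff.1 ((hr' v).trans_ne ((map_ne_zero v.1).2 hx0))
      have hc : ∀ v, (mixedEmbedding F x).2 v ≠ 0 := fun v =>
        norm_ne_zero_iff.1 ((hc' v).trans_ne ((map_ne_zero v.1).2 hx0))
      refine ⟨(fun v => ((mixedEmbedding F x).1 v)⁻¹ * (archScalar ρ.1.1).1 v,
        fun v => ((mixedEmbedding F x).2 v)⁻¹ * (archScalar ρ.1.1).2 v),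
        Prod.ext (funext fun v => mul_inv_cancel_left₀ (hr v) _)
          (funext fun v => mul_inv_cancel_left₀ (hc v) _), fun v => ?_, fun v => ?_⟩
      · have h0 : v.1 x ≠ 0 := (map_ne_zero _).2 hx0
        simp only [archScalar, hinf]
        rw [norm_mul, norm_inv, hr', Real.norm_of_nonneg (apply_nonneg _ _), inv_mul_cancel₀ h0]
      · have h0 : v.1 x ≠ 0 := (map_ne_zero _).2 hx0
        simp only [archScalar, hinf]
        rw [norm_mul, norm_inv, hc', Complex.norm_real, Real.norm_of_nonneg (apply_nonneg _ _),
          inv_mul_cancel₀ h0]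
    refine mk_eq_of_coe_eq_mul _ _ _ _ (Unitary.toUnits
      ⟨_, leftMulMatrix_archBasis_mem_unitary o u hu1 hu2⟩)
      (Subgroup.mem_sup_right ⟨_, rfl⟩) ?_
    change archMatrix w o (ρ.1.1 * t.1.1) = (gammaToGL n S ℝ A : Matrix (Fin n) (Fin n) ℝ) *
      archMatrix w o t.1.1 * (Algebra.leftMulMatrix (archBasis o) u).transpose
    rw [hA, archMatrix_eq_coordMatrix, archMatrix_eq_coordMatrix,
      map_leftMulMatrix_mul_coordMatrix, ← coordMatrix_mul, archScalar_mul, mul_assoc, hu]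
  -- Index 0 is used since the twist by `e` is already carried by the scalar of `t`.
  · obtain ⟨u, hu, hu1⟩ : ∃ u, localEmbedding p.1.1 x * u = padicScalar 0 (ρ.1.2 p) ∧
        ∀ v, ‖u v‖ = 1 := by
      have hne : ∀ v : PlaceAbove F p.1.1, localEmbedding p.1.1 x v ≠ 0 :=
        fun v => (map_ne_zero (algebraMap F (v.1.adicCompletion F))).2 hx0
      refine ⟨fun v => (localEmbedding p.1.1 x v)⁻¹ * padicScalar 0 (ρ.1.2 p) v,
        funext fun v => mul_inv_cancel_left₀ (hne v) _, fun v => ?_⟩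
      have h1 := (norm_algebraMap_eq_one_iff v.1 _).2 (hfin p v)
      rw [map_mul] at h1
      beta_reduce
      rw [localEmbedding_apply, padicScalar, Pi.zero_apply, zpow_zero, one_mul, map_inv₀,
        ← mul_inv, norm_inv, algebraMap_padic_ratCast, inv_eq_one]
      simpa using h1
    obtain ⟨U, hU, hUu⟩ := leftMulMatrix_basis_mem_padicIntegralSubgroup (c p) u hu1
    refine mk_eq_of_coe_eq_mul _ _ _ _ U (Subgroup.mem_sup_right hU) ?_
    change padicMatrix w (c p) (e p) (ρ.1.2 p * t.1.2 p) =
      (gammaToGL n S ℚ_[p.1.1] A : Matrix (Fin n) (Fin n) ℚ_[p.1.1]) *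
      padicMatrix w (c p) (e p) (t.1.2 p) * U
    rw [hA, hUu, padicMatrix_eq_coordMatrix, padicMatrix_eq_coordMatrix,
      map_leftMulMatrix_mul_coordMatrix, ← coordMatrix_mul, padicScalar_mul, mul_assoc, hu]

end Periods

/-! ### Powers of `S`-units that preserve the lattice -/

section Multipliers
variable {F : Type*} [Field F] [NumberField F] {n : ℕ} {S : Finset RatPrime}

lemma natCast_inv_eq_mul_inv_pow {q N k : ℕ} (hN : N ≠ 0) (hq : q ∣ N ^ k) :
    ∃ r : ℕ, (q : ℚ)⁻¹ = r * ((N : ℚ)⁻¹) ^ k := by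
  obtain ⟨r, hr⟩ := hq
  have h : (N : ℚ) ^ k = q * r := by exact_mod_cast hr
  have h0 : (q : ℚ) * r ≠ 0 := h ▸ pow_ne_zero _ (Nat.cast_ne_zero.2 hN)
  refine ⟨r, ?_⟩
  rw [inv_pow, h, mul_inv, mul_left_comm, mul_inv_cancel₀ (right_ne_zero_of_mul h0), mul_one]

lemma prod_inv_mem_invertedIntegers (S : Finset RatPrime) :
    ((∏ p ∈ S, p.1 : ℕ) : ℚ)⁻¹ ∈ invertedIntegers S :=
  Algebra.subset_adjoin (Set.mem_singleton _)

lemma inv_mem_invertedIntegers {q k : ℕ} (hq : q ∣ (∏ p ∈ S, p.1) ^ k) :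
    ((q : ℚ))⁻¹ ∈ invertedIntegers S := by
  obtain ⟨r, hr⟩ := natCast_inv_eq_mul_inv_pow
    (Finset.prod_ne_zero_iff.2 fun p _ => p.2.ne_zero) hq
  rw [hr]
  exact mul_mem (natCast_mem _ r) (pow_mem (prod_inv_mem_invertedIntegers S) k)

lemma ratCast_mem_multiplierRing (w : Module.Basis (Fin n) ℚ F) {q : ℚ}
    (hq : q ∈ invertedIntegers S) : (q : F) ∈ multiplierRing w S := by
  rw [mem_multiplierRing]
  intro i j
  have : Algebra.leftMulMatrix w (q : F) = algebraMap ℚ _ q := by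
    rw [← AlgHom.commutes (Algebra.leftMulMatrix w) q]
    simp
  rw [this, Matrix.algebraMap_matrix_apply]
  split_ifs
  · simpa using hq
  · exact zero_mem _

/-- A common denominator for the multiplication matrices of an integral basis suffices. -/
lemma exists_natCast_mul_mem_multiplierRing (w : Module.Basis (Fin n) ℚ F) :
    ∃ d : ℕ, 0 < d ∧ ∀ x : 𝓞 F, (d : F) * x ∈ multiplierRing w S := by
  let B := RingOfIntegers.basis F
  let den : Module.Free.ChooseBasisIndex ℤ (𝓞 F) → Fin n → Fin n → ℕ :=
    fun k i j => (Algebra.leftMulMatrix w (B k : F) i j).den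
  refine ⟨∏ k, ∏ i, ∏ j, den k i j,
    Finset.prod_pos fun k _ => Finset.prod_pos fun i _ => Finset.prod_pos fun j _ => Rat.den_pos _,
    fun x => ?_⟩
  have hx : (x : F) = ∑ k, (B.repr x k : F) * (B k : F) := by
    conv_lhs => rw [← B.sum_repr x]
    rw [RingOfIntegers.coe_eq_algebraMap, map_sum]
    refine Finset.sum_congr rfl fun k _ => ?_
    rw [zsmul_eq_mul, map_mul, map_intCast]
  rw [hx, Finset.mul_sum]
  refine sum_mem fun k _ => ?_
  rw [mul_left_comm]
  refine mul_mem (intCast_mem _ _) ?_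
  rw [mem_multiplierRing]
  intro i j
  rw [map_mul, map_natCast, ← nsmul_eq_mul, Matrix.smul_apply, nsmul_eq_mul]
  have hdvd : den k i j ∣ ∏ k, ∏ i, ∏ j, den k i j :=
    (Finset.dvd_prod_of_mem _ (Finset.mem_univ j)).trans
      ((Finset.dvd_prod_of_mem (fun i => ∏ j, den k i j) (Finset.mem_univ i)).trans
        (Finset.dvd_prod_of_mem (fun k => ∏ i, ∏ j, den k i j) (Finset.mem_univ k)))
  obtain ⟨r, hr⟩ := hdvd
  rw [hr, Nat.cast_mul, mul_right_comm, mul_comm ((den k i j : ℕ) : ℚ), Rat.mul_den_eq_num]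
  exact mul_mem (intCast_mem _ _) (natCast_mem _ _)

/-- The least admissible `d` works: a prime dividing both `d` and `N` is invertible in the
multiplier ring and could be cancelled. -/
lemma exists_coprime_natCast_mul_mem_multiplierRing (w : Module.Basis (Fin n) ℚ F)
    (S : Finset RatPrime) :
    ∃ d : ℕ, 0 < d ∧ d.Coprime (∏ p ∈ S, p.1) ∧ ∀ x : 𝓞 F, (d : F) * x ∈ multiplierRing w S := by
  classical
  have hex := exists_natCast_mul_mem_multiplierRing (S := S) w
  obtain ⟨hd0, hd⟩ := Nat.find_spec hex
  refine ⟨Nat.find hex, hd0, ?_, hd⟩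
  rw [Nat.coprime_iff_gcd_eq_one]
  by_contra hg
  obtain ⟨q, hq, hqg⟩ := Nat.exists_prime_and_dvd hg
  obtain ⟨r, hr⟩ := hqg.trans (Nat.gcd_dvd_left _ _)
  have hr0 : 0 < r := Nat.pos_of_ne_zero fun h => by
    rw [h, mul_zero] at hr
    exact hd0.ne' hr
  refine Nat.find_min hex (m := r) ?_ ⟨hr0, fun x => ?_⟩
  · rw [hr]
    exact lt_mul_of_one_lt_left hr0 hq.one_lt
  have hqF : (q : F) ≠ 0 := Nat.cast_ne_zero.2 hq.ne_zero
  have hqi : (((q : ℚ)⁻¹ : ℚ) : F) ∈ multiplierRing w S :=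
    ratCast_mem_multiplierRing w
      (inv_mem_invertedIntegers (k := 1) (by simpa using hqg.trans (Nat.gcd_dvd_right _ _)))
  have := mul_mem hqi (hd x)
  rw [hr] at this
  push_cast at this
  rwa [mul_assoc, inv_mul_cancel_left₀ hqF] at this

/-- A divisor of a power of `N` is a unit modulo the coprime conductor `d`. With `m` the order of
`(𝓞 F / d)ˣ`, its `m`-th power lies in `1 + d 𝓞 F`, hence in the multiplier ring. -/
lemma exists_pow_mem_multiplierRing (w : Module.Basis (Fin n) ℚ F) (S : Finset RatPrime) :
    ∃ m : ℕ, 0 < m ∧ ∀ (x : 𝓞 F) (k : ℕ), x ∣ ((∏ p ∈ S, p.1 : ℕ) : 𝓞 F) ^ k →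
      (x : F) ^ m ∈ multiplierRing w S ∧ ((x : F) ^ m)⁻¹ ∈ multiplierRing w S := by
  obtain ⟨d, hd0, hcop, hd⟩ := exists_coprime_natCast_mul_mem_multiplierRing w S
  set N := ∏ p ∈ S, p.1 with hN
  have hN0 : N ≠ 0 := Finset.prod_ne_zero_iff.2 fun p _ => p.2.ne_zero
  let I : Ideal (𝓞 F) := Ideal.span {(d : 𝓞 F)}
  have hI : I ≠ ⊥ := by
    simpa [I] using hd0.ne'
  have : Finite (𝓞 F ⧸ I) := I.finiteQuotientOfFreeOfNeBot hI
  have hpow : ∀ (x : 𝓞 F) (k : ℕ), x ∣ (N : 𝓞 F) ^ k →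
      (x : F) ^ Nat.card (𝓞 F ⧸ I)ˣ ∈ multiplierRing w S := by
    intro x k hx
    have hu : IsUnit (Ideal.Quotient.mk I x) := by
      refine isUnit_of_dvd_unit (map_dvd (Ideal.Quotient.mk I) hx) ?_
      rw [map_pow]
      refine IsUnit.pow _ ?_
      obtain ⟨a, b, hab⟩ := Nat.isCoprime_iff_coprime.2 hcop
      refine IsUnit.of_mul_eq_one (Ideal.Quotient.mk I (b : 𝓞 F)) ?_
      rw [← map_mul, ← map_one (Ideal.Quotient.mk I), Ideal.Quotient.mk_eq_mk_iff_sub_mem,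
        Ideal.mem_span_singleton]
      refine ⟨-a, ?_⟩
      have : (a : 𝓞 F) * d + b * N = 1 := by exact_mod_cast congrArg (Int.cast : ℤ → 𝓞 F) hab
      linear_combination this
    obtain ⟨u, hu⟩ := hu
    have h1 : Ideal.Quotient.mk I (x ^ Nat.card (𝓞 F ⧸ I)ˣ) = Ideal.Quotient.mk I 1 := by
      rw [map_pow, ← hu, ← Units.val_pow_eq_pow_val, pow_card_eq_one', Units.val_one, map_one]
    rw [Ideal.Quotient.mk_eq_mk_iff_sub_mem, Ideal.mem_span_singleton] at h1
    obtain ⟨z, hz⟩ := h1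
    have h2 : (x : F) ^ Nat.card (𝓞 F ⧸ I)ˣ = 1 + (d : F) * z := by
      rw [sub_eq_iff_eq_add'] at hz
      have := congrArg (algebraMap (𝓞 F) F) hz
      simpa using this
    rw [h2]
    exact add_mem (one_mem _) (hd z)
  refine ⟨_, Nat.card_pos, fun x k hx => ⟨hpow x k hx, ?_⟩⟩
  obtain ⟨y, hy⟩ := hx
  have h1 : (x : F) * y = ((N ^ k : ℕ) : F) := by
    have := congrArg (algebraMap (𝓞 F) F) hy
    simpa using this.symm
  have h2 : ((N ^ k : ℕ) : F) ≠ 0 := Nat.cast_ne_zero.2 (pow_ne_zero _ hN0)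
  -- The cofactor `y` also divides `N ^ k`, so the first half applies to it, and `N` is invertible.
  have h3 : (x : F)⁻¹ = y * (((((N ^ k : ℕ) : ℚ)⁻¹ : ℚ)) : F) := by
    have hx0 : (x : F) ≠ 0 := left_ne_zero_of_mul (h1.trans_ne h2)
    rw [Rat.cast_inv, Rat.cast_natCast, ← h1]
    have hy0 : (y : F) ≠ 0 := right_ne_zero_of_mul (h1.trans_ne h2)
    field_simp
  rw [← inv_pow, h3, mul_pow]
  exact mul_mem (hpow y k ⟨x, by rw [hy, mul_comm]⟩)
    (pow_mem (ratCast_mem_multiplierRing w (inv_mem_invertedIntegers (k := k) (by rw [hN]))) _)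

end Multipliers

lemma coe_prod_positive {ι : Type*} (s : Finset ι) (f : ι → {x : ℝ // 0 < x}) :
    ((∏ v ∈ s, f v : {x : ℝ // 0 < x}) : ℝ) = ∏ v ∈ s, (f v : ℝ) := by
  classical
  induction s using Finset.induction_on with
  | empty => rfl
  | insert a s ha ih => rw [Finset.prod_insert ha, Finset.prod_insert ha, ← ih]; rfl

/-! ### Generators of powers of prime ideals -/

section Generators
variable {F : Type*} [Field F] [NumberField F]

lemma exists_span_singleton_eq_pow_classNumber (v : HeightOneSpectrum (𝓞 F)) :
    ∃ a : 𝓞 F, Ideal.span {a} = v.asIdeal ^ classNumber F := by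
  let I : nonZeroDivisors (Ideal (𝓞 F)) := ⟨v.asIdeal, mem_nonZeroDivisors_iff_ne_zero.2 v.ne_bot⟩
  have h : ClassGroup.mk0 (I ^ classNumber F) = 1 := by
    rw [map_pow, classNumber, pow_card_eq_one]
  rw [ClassGroup.mk0_eq_one_iff] at h
  obtain ⟨⟨a, ha⟩⟩ := h
  exact ⟨a, ha.symm⟩

lemma valuation_eq_one_of_span_eq_pow {v v' : HeightOneSpectrum (𝓞 F)} (hvv : v' ≠ v) {a : 𝓞 F}
    {h : ℕ} (ha : Ideal.span {a} = v.asIdeal ^ h) : v'.valuation F (a : F) = 1 := by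
  refine (HeightOneSpectrum.valuation_eq_one_iff_notMem (K := F) v').2 fun hmem => hvv ?_
  have h1 : v.asIdeal ^ h ≤ v'.asIdeal := by
    rw [← ha, Ideal.span_singleton_le_iff_mem]
    exact hmem
  have h2 : v.asIdeal ≤ v'.asIdeal := v'.isPrime.le_of_pow_le h1
  exact HeightOneSpectrum.ext (v.isMaximal.eq_of_le v'.isPrime.ne_top h2).symm

/-- One inequality is `a ∈ v ^ h`; the other holds because `a` divides the `h`-th power of a
uniformizer. -/
lemma valuation_eq_exp_pow_of_span_eq_pow {v : HeightOneSpectrum (𝓞 F)} {a : 𝓞 F}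
    {h : ℕ} (ha : Ideal.span {a} = v.asIdeal ^ h) :
    v.valuation F (a : F) = WithZero.exp (-1 : ℤ) ^ h := by
  obtain ⟨π, hπ⟩ := v.intValuation_exists_uniformizer
  have h1 : a ∈ v.asIdeal ^ h := by
    rw [← ha]; exact Ideal.mem_span_singleton_self a
  have h2 : π ^ h ∈ v.asIdeal ^ h := by
    refine Ideal.pow_mem_pow ?_ h
    rw [← v.intValuation_lt_one_iff_mem, hπ, ← WithZero.exp_zero, WithZero.exp_lt_exp]
    norm_num
  rw [← ha, Ideal.mem_span_singleton] at h2
  obtain ⟨b, hb⟩ := h2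
  have h3 := congrArg v.intValuation hb
  rw [map_pow, map_mul, hπ] at h3
  change v.valuation F (algebraMap (𝓞 F) F a) = _
  rw [v.valuation_of_algebraMap]
  refine le_antisymm ?_ ?_
  · rw [← WithZero.exp_nsmul]
    simpa using (v.intValuation_le_pow_iff_mem a h).2 h1
  · rw [h3]
    exact mul_le_of_le_one_right' (v.intValuation_le_one b)

end Generators

/-! ### Periods from units and from prime generators -/

section Periods
variable {F : Type*} [Field F] [NumberField F] {n : ℕ} {S : Finset RatPrime}

/-- The archimedean absolute values, weighted by multiplicity, multiply to `|N x| = 1`, so the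
archimedean part of the period need not be prescribed. -/
lemma exists_mem_periodLattice_of_mem_multiplierRing (w : Module.Basis (Fin n) ℚ F)
    (o : mixedEmbedding.index F ≃ Fin n) (c : ∀ p : S, PadicFrame F p.1.1 n)
    (e : ∀ p : S, PlaceAbove F p.1.1 → ℤ) {x : F} (hx : x ∈ multiplierRing w S)
    (hN : Algebra.norm ℚ x = 1) (δ : ∀ p : S, PlaceAbove F p.1.1 → primePowers p.1.1)
    (hδ : ∀ p, ∏ v, δ p v ^ localDegree v = 1)
    (hfin : ∀ (p : S) (v : PlaceAbove F p.1.1), v.1.valuation F (x * ((δ p v : ℚˣ) : ℚ)) = 1) :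
    ∃ ρ ∈ periodLattice (heegnerObject w o c e), ρ.1.2 = δ ∧ ∀ v, (ρ.1.1 v : ℝ) = v x := by
  have hx0 : x ≠ 0 := by
    rintro rfl
    simp at hN
  have hpos : ∀ v : InfinitePlace F, 0 < v x := fun v => InfinitePlace.pos_iff.2 hx0
  have hprod : ∏ v : InfinitePlace F, (⟨v x, hpos v⟩ : {x : ℝ // 0 < x}) ^ v.mult = 1 := by
    apply Subtype.ext
    have h1 := InfinitePlace.prod_eq_abs_norm x
    rw [hN, abs_one, Rat.cast_one] at h1
    rw [coe_prod_positive]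
    exact h1
  let ρ : normOneTorus F S := ⟨(fun v => ⟨v x, hpos v⟩, δ), hprod, hδ⟩
  exact ⟨ρ, mem_periodLattice_of_mem_multiplierRing w o c e hx hN ρ (fun v => rfl) hfin, rfl,
    fun v => rfl⟩

/-- An even exponent removes the sign, since `Γ_S` requires determinant exactly 1. -/
lemma norm_pow_two_eq_one {x : F} (hx : |Algebra.norm ℚ x| = 1) (m : ℕ) :
    Algebra.norm ℚ (x ^ (2 * m)) = 1 := by
  rw [map_pow, pow_mul, ← sq_abs, hx, one_pow, one_pow]

lemma exists_pow_unit_mem_periodLattice (w : Module.Basis (Fin n) ℚ F)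
    (o : mixedEmbedding.index F ≃ Fin n) (c : ∀ p : S, PadicFrame F p.1.1 n)
    (e : ∀ p : S, PlaceAbove F p.1.1 → ℤ) :
    ∃ M : ℕ, 0 < M ∧ ∀ u : (𝓞 F)ˣ, ∃ ρ ∈ periodLattice (heegnerObject w o c e),
      ρ.1.2 = 1 ∧ ∀ v : InfinitePlace F, (ρ.1.1 v : ℝ) = v u ^ M := by
  obtain ⟨m, hm0, hm⟩ := exists_pow_mem_multiplierRing w S
  refine ⟨2 * m, by positivity, fun u => ?_⟩
  have hmem : (u : F) ^ (2 * m) ∈ multiplierRing w S := by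
    rw [mul_comm, pow_mul]
    -- Exponent 0 is allowed: a unit divides `N ^ 0 = 1`.
    exact pow_mem (hm u 0 (by rw [pow_zero]; exact u.isUnit.dvd)).1 2
  obtain ⟨ρ, h1, h2, h3⟩ := exists_mem_periodLattice_of_mem_multiplierRing w o c e hmem
    (norm_pow_two_eq_one (NumberField.Units.norm F u) m) 1 (fun p => by simp) (fun p v => by
      have : v.1.valuation F (u : F) = 1 :=
        (HeightOneSpectrum.valuation_eq_one_iff_notMem (K := F) v.1).2 fun h =>
          v.1.isPrime.ne_top (Ideal.eq_top_of_isUnit_mem _ h u.isUnit)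
      simp [this])
  exact ⟨ρ, h1, h2, fun v => by rw [h3, map_pow]⟩

lemma PlaceAbove.ne_of_ne {p q : ℕ} (hp : p.Prime) (hq : q.Prime) (hpq : p ≠ q)
    (v : PlaceAbove F p) (v' : PlaceAbove F q) : v.1 ≠ v'.1 := by
  intro h
  obtain ⟨a, b, hab⟩ := Nat.isCoprime_iff_coprime.2 ((Nat.coprime_primes hp hq).2 hpq)
  refine v.1.isPrime.ne_top ((Ideal.eq_top_iff_one _).2 ?_)
  have h1 : (a : 𝓞 F) * p + b * q = 1 := by exact_mod_cast congrArg (Int.cast : ℤ → 𝓞 F) hab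
  rw [← h1]
  exact Ideal.add_mem _ (Ideal.mul_mem_left _ _ v.2) (Ideal.mul_mem_left _ _ (h ▸ v'.2))

lemma zpow_mem_of_inv_mem {K : Type*} [Field K] {R : Subring K} {x : K} (h1 : x ∈ R)
    (h2 : x⁻¹ ∈ R) (k : ℤ) : x ^ k ∈ R := by
  cases k with
  | ofNat k => simpa using pow_mem h1 k
  | negSucc k =>
    rw [zpow_negSucc, ← inv_pow]
    exact pow_mem h2 _

/-- In the exponent `2 * m * h`, the class number `h` makes `v ^ h` principal, `m` brings the
element into the multiplier ring, and 2 removes the sign of the norm. -/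
lemma exists_pow_eq_of_mem_periodLattice (hS : IsUnramifiedIn F S) (w : Module.Basis (Fin n) ℚ F)
    (o : mixedEmbedding.index F ≃ Fin n) (c : ∀ p : S, PadicFrame F p.1.1 n)
    (e : ∀ p : S, PlaceAbove F p.1.1 → ℤ) :
    ∃ M : ℕ, 0 < M ∧ ∀ δ : ∀ p : S, PlaceAbove F p.1.1 → primePowers p.1.1,
      (∀ p, ∏ v, δ p v ^ localDegree v = 1) →
        ∃ ρ ∈ periodLattice (heegnerObject w o c e), ρ.1.2 = δ ^ M := by
  classical
  obtain ⟨m, hm0, hm⟩ := exists_pow_mem_multiplierRing w S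
  have hunr : ∀ (p : S) (v : PlaceAbove F p.1.1), Algebra.IsUnramifiedAt ℤ v.1.asIdeal :=
    fun p v => hS p.1 p.2 v
  set h := classNumber F with hh
  have hh0 : 0 < h := Fintype.card_pos
  choose a ha using fun (p : S) (v : PlaceAbove F p.1.1) =>
    exists_span_singleton_eq_pow_classNumber v.1
  refine ⟨2 * m * h, by positivity, fun δ hδ => ?_⟩
  have hk : ∀ p v, ∃ k : ℤ, (((δ p v : ℚˣ) : ℚ)) = (p.1.1 : ℚ) ^ k := fun p v => by
    obtain ⟨k, hk⟩ := Subgroup.mem_zpowers_iff.1 (δ p v).2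
    exact ⟨k, by rw [← hk]; simp⟩
  choose k hk using hk
  -- Since `p ^ h ∈ v ^ h = (a p v)`, the generator divides `N ^ h`.
  have hmem : ∀ p v, (a p v : F) ^ m ∈ multiplierRing w S ∧
      ((a p v : F) ^ m)⁻¹ ∈ multiplierRing w S := fun p v => by
    refine hm (a p v) h ?_
    have h1 : (p.1.1 : 𝓞 F) ^ h ∈ Ideal.span {a p v} := by
      rw [ha]; exact Ideal.pow_mem_pow v.2 _
    refine (Ideal.mem_span_singleton.1 h1).trans (pow_dvd_pow_of_dvd ?_ h)
    exact_mod_cast Nat.cast_dvd_cast (Finset.dvd_prod_of_mem (fun p : RatPrime => p.1) p.2)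
  -- The generator of `v ^ h` has the valuation of `p ^ h` at `v` and is a unit at the other primes,
  -- so these exponents cancel `δ ^ h`.
  set x : F := ∏ p, ∏ v, (a p v : F) ^ (-k p v) with hx
  have hval : ∀ (p : S) (v : PlaceAbove F p.1.1),
      v.1.valuation F (x * (((δ p v : ℚˣ) : ℚ) : F) ^ h) = 1 := fun p v => by
    have := hunr p v
    have h1 : v.1.valuation F x = (v.1.valuation F (a p v : F)) ^ (-k p v) := by
      rw [hx, map_prod, Finset.prod_eq_single p, map_prod, Finset.prod_eq_single v, map_zpow₀]
      · intro v' _ hv'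
        rw [map_zpow₀, valuation_eq_one_of_span_eq_pow (fun h => hv' (Subtype.ext h.symm)) (ha p v'),
          one_zpow]
      · simp
      · intro q _ hq
        rw [map_prod]
        refine Finset.prod_eq_one fun v' _ => ?_
        rw [map_zpow₀, valuation_eq_one_of_span_eq_pow
          (PlaceAbove.ne_of_ne p.1.2 q.1.2 (fun h => hq (Subtype.ext (Subtype.ext h.symm))) v v')
          (ha q v'), one_zpow]
      · simp
    rw [map_mul, h1, valuation_eq_exp_pow_of_span_eq_pow (ha p v), hk]
    push_cast
    rw [map_pow, map_zpow₀, valuation_natCast_of_isUnramifiedAt v, ← hh, zpow_neg,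
      ← zpow_natCast (_ ^ k p v), ← zpow_mul, ← zpow_natCast, ← zpow_mul, mul_comm (k p v)]
    exact inv_mul_cancel₀ (zpow_ne_zero _ WithZero.exp_ne_zero)
  -- Each generator has absolute norm `p ^ (n_v h)`, so the contribution of `p` is `(∏ δ_v ^ n_v) ^
  -- (-h) = 1`.
  have hNx : |Algebra.norm ℚ x| = 1 := by
    have h1 : ∀ p v, |Algebra.norm ℚ (a p v : F)| = ((p.1.1 : ℚ) ^ localDegree v) ^ h := by
      intro p v
      have := hunr p v
      have h2 := congrArg Ideal.absNorm (ha p v)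
      rw [map_pow, absNorm_eq_pow_localDegree (c p) v, Ideal.absNorm_span_singleton] at h2
      rw [← Algebra.coe_norm_int, ← Int.cast_abs, Int.abs_eq_natAbs, Int.cast_natCast, h2]
      push_cast
      rfl
    rw [hx, map_prod, Finset.abs_prod]
    refine Finset.prod_eq_one fun p _ => ?_
    rw [map_prod, Finset.abs_prod]
    have h2 : ∏ v, ((δ p v : ℚˣ) : ℚ) ^ localDegree v = 1 := by
      have := congrArg (fun y : primePowers p.1.1 => ((y : ℚˣ) : ℚ)) (hδ p)
      simpa using this
    calc ∏ v, |Algebra.norm ℚ ((a p v : F) ^ (-k p v))|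
        = ∏ v, ((((δ p v : ℚˣ) : ℚ) ^ localDegree v) ^ h)⁻¹ := Finset.prod_congr rfl fun v _ => by
          rw [Algebra.norm_zpow, abs_zpow, h1, hk, zpow_neg]
          simp only [← zpow_natCast, ← zpow_mul]
          ring_nf
      _ = 1 := by rw [Finset.prod_inv_distrib, Finset.prod_pow, h2, one_pow, inv_one]
  have hxm : x ^ (2 * m) ∈ multiplierRing w S := by
    rw [mul_comm, pow_mul]
    refine pow_mem ?_ 2
    rw [hx, ← Finset.prod_pow]
    refine prod_mem fun p _ => ?_
    rw [← Finset.prod_pow]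
    refine prod_mem fun v _ => ?_
    rw [← zpow_natCast, zpow_comm, zpow_natCast]
    exact zpow_mem_of_inv_mem (hmem p v).1 (hmem p v).2 _
  obtain ⟨ρ, hρ, hρ2, -⟩ := exists_mem_periodLattice_of_mem_multiplierRing w o c e hxm
    (norm_pow_two_eq_one hNx m) (δ ^ (2 * m * h)) (fun p => by
      simp only [Pi.pow_apply, ← pow_mul, mul_comm (2 * m * h)]
      simp only [pow_mul _ _ (2 * m * h), Finset.prod_pow, hδ p, one_pow]) (fun p v => by
      have : x ^ (2 * m) * ((((δ ^ (2 * m * h)) p v : primePowers p.1.1) : ℚˣ) : ℚ) =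
          (x * (((δ p v : ℚˣ) : ℚ) : F) ^ h) ^ (2 * m) := by
        simp only [Pi.pow_apply]
        push_cast
        ring
      rw [this, map_pow, hval, one_pow])
  exact ⟨ρ, hρ, hρ2⟩

end Periods

/-! ### Logarithmic coordinates and Dirichlet's unit theorem -/

section LogSpace
variable {F : Type*} [Field F] [NumberField F]
open Units.dirichletUnitTheorem

/-- The logarithms of a family indexed by the infinite places. -/
noncomputable def logVector (t : InfinitePlace F → {x : ℝ // 0 < x}) : logSpace F :=
  fun v => v.1.mult * Real.log (t v.1)

open scoped Classical in
/-- The family of norm one with given logarithms. -/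
noncomputable def expVector (y : logSpace F) (v : InfinitePlace F) : {x : ℝ // 0 < x} :=
  ⟨Real.exp ((if h : v = w₀ then -∑ i, y i else y ⟨v, h⟩) / v.mult), Real.exp_pos _⟩

lemma continuous_expVector : Continuous (expVector (F := F)) := by
  refine continuous_pi fun v => Continuous.subtype_mk (Real.continuous_exp.comp
    (Continuous.div_const ?_ _)) _
  split_ifs
  · exact (continuous_finsetSum _ fun i _ => continuous_apply i).neg
  · exact continuous_apply _

open scoped Classical in
lemma prod_expVector (y : logSpace F) : ∏ v, expVector y v ^ v.mult = 1 := by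
  apply Subtype.ext
  rw [coe_prod_positive]
  have h : ∀ v : InfinitePlace F, ((expVector y v ^ v.mult : {x : ℝ // 0 < x}) : ℝ) =
      Real.exp (if h : v = w₀ then -∑ i, y i else y ⟨v, h⟩) := fun v => by
    have h0 : (v.mult : ℝ) ≠ 0 := InfinitePlace.mult_coe_ne_zero
    change Real.exp _ ^ v.mult = _
    rw [← Real.exp_nat_mul, mul_div_cancel₀ _ h0]
  simp_rw [h]
  rw [← Real.exp_sum, Fintype.sum_eq_add_sum_subtype_ne _ w₀]
  simp only [dite_true]
  have h2 : ∑ i : {v : InfinitePlace F // v ≠ w₀},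
      (if h : i.1 = w₀ then -∑ j, y j else y ⟨i.1, h⟩) = ∑ i, y i :=
    Finset.sum_congr rfl fun i _ => dif_neg i.2
  rw [h2, neg_add_cancel, Real.exp_zero]
  rfl

open scoped Classical in
-- `logSpace` omits the place `w₀`; the norm-one condition recovers that coordinate as minus the sum
-- of the others.
lemma expVector_logVector (t : InfinitePlace F → {x : ℝ // 0 < x})
    (ht : ∏ v, t v ^ v.mult = 1) : expVector (logVector t) = t := by
  have hlog : ∑ v : InfinitePlace F, v.mult * Real.log (t v) = 0 := by
    have h := congrArg (fun y : {x : ℝ // 0 < x} => Real.log y) ht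
    simp only [coe_prod_positive] at h
    rw [Real.log_prod fun v _ => (t v ^ v.mult).2.ne'] at h
    refine Eq.trans (Finset.sum_congr rfl fun v _ => ?_) (h.trans Real.log_one)
    rw [← Real.log_pow]
    rfl
  rw [Fintype.sum_eq_add_sum_subtype_ne _ w₀] at hlog
  refine funext fun v => Subtype.ext ?_
  have h0 : (v.mult : ℝ) ≠ 0 := InfinitePlace.mult_coe_ne_zero
  have h1 : (if h : v = w₀ then -∑ i, logVector t i else logVector t ⟨v, h⟩) =
      v.mult * Real.log (t v) := by
    split_ifs with h
    · subst h
      exact (eq_neg_of_add_eq_zero_left hlog).symm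
    · rfl
  change Real.exp (_ / _) = _
  rw [h1, mul_div_cancel_left₀ _ h0, Real.exp_log (t v).2]

open scoped Classical in
-- By Dirichlet's theorem the unit lattice has full rank, so fractional parts with respect to a
-- basis of it are bounded.
lemma exists_norm_sub_logEmbedding_le (F : Type*) [Field F] [NumberField F] :
    ∃ r : ℝ, ∀ y : logSpace F, ∃ u : (𝓞 F)ˣ,
      ‖y - Units.logEmbedding F (Additive.ofMul u)‖ ≤ r := by
  let b := (Units.basisUnitLattice F).ofZLatticeBasis ℝ (Units.unitLattice F)
  refine ⟨∑ i, ‖b i‖, fun y => ?_⟩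
  have hmem : (ZSpan.floor b y : logSpace F) ∈ Units.unitLattice F := by
    have h : Submodule.span ℤ (Set.range b) = Units.unitLattice F :=
      (Units.basisUnitLattice F).ofZLatticeBasis_span ℝ (Units.unitLattice F)
    exact h.le (ZSpan.floor b y).2
  obtain ⟨u, -, hu⟩ := hmem
  exact ⟨Additive.toMul u, by
    have := ZSpan.norm_fract_le b y
    rw [ZSpan.fract_apply, ← hu] at this
    exact this⟩

end LogSpace

/-! ### The group `p^ℤ` is discrete and torsion-free -/

section PrimePowers
variable {p : ℕ} [hp : Fact p.Prime]

lemma exists_zpow_eq_primePowers (y : primePowers p) :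
    ∃ k : ℤ, (((y : ℚˣ)) : ℚ) = (p : ℚ) ^ k := by
  obtain ⟨k, hk⟩ := Subgroup.mem_zpowers_iff.1 y.2
  exact ⟨k, by rw [← hk]; simp⟩

lemma eq_one_of_pow_eq_one {y : primePowers p} {m : ℕ} (hm : 0 < m) (h : y ^ m = 1) : y = 1 := by
  obtain ⟨k, hk⟩ := exists_zpow_eq_primePowers y
  have hp0 : (0 : ℚ) < p := by exact_mod_cast hp.out.pos
  have h1 : (((y : ℚˣ)) : ℚ) ^ m = 1 := by
    have := congrArg (fun y : primePowers p => ((y : ℚˣ) : ℚ)) h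
    simpa using this
  refine Subtype.ext (Units.ext ?_)
  exact (pow_eq_one_iff_of_nonneg (by rw [hk]; positivity) hm.ne').1 h1

instance : DiscreteTopology (primePowers p) := by
  have h : IsOpen ({1} : Set (primePowers p)) := by
    -- As `p ≥ 2`, every other power is at most `1/2` or at least `2`; the interval must be open at
    -- `1/2` to exclude `2⁻¹`.
    have hset : ({1} : Set (primePowers p)) =
        (fun y : primePowers p => ((y : ℚˣ) : ℚ)) ⁻¹' Set.Ioo (1 / 2) (3 / 2) := by
      ext y
      rw [Set.mem_singleton_iff, Set.mem_preimage, Set.mem_Ioo]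
      constructor
      · rintro rfl
        norm_num
      rintro ⟨h1, h2⟩
      obtain ⟨k, hk⟩ := exists_zpow_eq_primePowers y
      have hp2 : (2 : ℚ) ≤ p := by exact_mod_cast hp.out.two_le
      refine Subtype.ext (Units.ext ?_)
      rw [hk] at h1 h2 ⊢
      rcases lt_trichotomy k 0 with hk0 | rfl | hk0
      · exfalso
        have h3 : (p : ℚ) ^ k ≤ (p : ℚ) ^ (-1 : ℤ) :=
          zpow_le_zpow_right₀ (by linarith) (by lia)
        rw [zpow_neg_one] at h3
        have h4 : (p : ℚ)⁻¹ ≤ 2⁻¹ := inv_anti₀ (by norm_num) hp2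
        linarith
      · simp
      · exfalso
        have h3 : (p : ℚ) ^ (1 : ℤ) ≤ (p : ℚ) ^ k :=
          zpow_le_zpow_right₀ (by linarith) (by lia)
        rw [zpow_one] at h3
        linarith
    rw [hset]
    exact isOpen_Ioo.preimage (Units.continuous_val.comp continuous_subtype_val)
  exact discreteTopology_of_isOpen_singleton_one h

end PrimePowers

/-! ### Finite parts modulo powers -/

section FiniteReps
variable {F : Type*} [Field F] [NumberField F] {S : Finset RatPrime}

/-- Exponent vectors take finitely many values modulo `M`. The cofactor `η` again satisfies the
norm-one condition, because its local norms are killed by `M` and `p^ℤ` is torsion-free. -/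
lemma exists_finite_representatives_pow (M : ℕ) (hM : 0 < M) :
    ∃ R : Set (∀ p : S, PlaceAbove F p.1.1 → primePowers p.1.1), R.Finite ∧
      (∀ δ ∈ R, ∀ p, ∏ v, δ p v ^ localDegree v = 1) ∧
      ∀ δ : ∀ p : S, PlaceAbove F p.1.1 → primePowers p.1.1,
        (∀ p, ∏ v, δ p v ^ localDegree v = 1) →
        ∃ δ₀ ∈ R, ∃ η : ∀ p : S, PlaceAbove F p.1.1 → primePowers p.1.1,
          (∀ p, ∏ v, η p v ^ localDegree v = 1) ∧ δ = δ₀ * η ^ M := by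
  classical
  have : NeZero M := ⟨hM.ne'⟩
  let D := {δ : ∀ p : S, PlaceAbove F p.1.1 → primePowers p.1.1 //
    ∀ p, ∏ v, δ p v ^ localDegree v = 1}
  let gen : ∀ p : S, primePowers p.1.1 := fun p => ⟨_, Subgroup.mem_zpowers _⟩
  have hk : ∀ (δ : D) p v, ∃ k : ℤ, δ.1 p v = gen p ^ k := fun δ p v => by
    obtain ⟨k, hk⟩ := Subgroup.mem_zpowers_iff.1 (δ.1 p v).2
    exact ⟨k, Subtype.ext hk.symm⟩
  choose k hk using hk
  let κ : D → ∀ p : S, PlaceAbove F p.1.1 → ZMod M := fun δ p v => (k δ p v : ZMod M)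
  -- One norm-one family is chosen for each residue vector that such families attain.
  refine ⟨Set.range fun y : Set.range κ => (y.2.choose).1, Set.finite_range _, ?_, fun δ hδ => ?_⟩
  · rintro _ ⟨y, rfl⟩
    exact y.2.choose.2
  let δ₀ : D := (⟨κ ⟨δ, hδ⟩, ⟨δ, hδ⟩, rfl⟩ : Set.range κ).2.choose
  have hδ₀ : κ δ₀ = κ ⟨δ, hδ⟩ := (⟨κ ⟨δ, hδ⟩, ⟨δ, hδ⟩, rfl⟩ : Set.range κ).2.choose_spec
  have hj : ∀ p v, ∃ j : ℤ, k ⟨δ, hδ⟩ p v - k δ₀ p v = M * j := fun p v => by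
    have := congrFun (congrFun hδ₀ p) v
    exact (ZMod.intCast_eq_intCast_iff_dvd_sub _ _ _).1 this
  choose j hj using hj
  have heq : δ = δ₀.1 * (fun p v => gen p ^ j p v) ^ M := by
    refine funext fun p => funext fun v => ?_
    simp only [Pi.mul_apply, Pi.pow_apply]
    rw [hk δ₀ p v, ← zpow_natCast, ← zpow_mul, ← zpow_add, mul_comm (j p v), ← hj,
      add_sub_cancel]
    exact hk ⟨δ, hδ⟩ p v
  refine ⟨δ₀.1, ⟨_, rfl⟩, fun p v => gen p ^ j p v, fun p => ?_, heq⟩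
  refine eq_one_of_pow_eq_one hM ?_
  have h1 := hδ p
  rw [heq] at h1
  simp only [Pi.mul_apply, Pi.pow_apply, mul_pow, Finset.prod_mul_distrib] at h1
  rw [δ₀.2 p, one_mul] at h1
  rw [← Finset.prod_pow, ← h1]
  exact Finset.prod_congr rfl fun v _ => pow_right_comm _ _ _

end FiniteReps

/-! ### Continuity of the Heegner object -/

section Continuity
variable {F : Type*} [Field F] [NumberField F] {n : ℕ} {S : Finset RatPrime}

/-- The unit-group topology also requires the inverse to be continuous; it is the adjugate divided
by the determinant. -/
lemma continuous_generalLinearGroup_mk'' {X K : Type*} [TopologicalSpace X] [Field K]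
    [TopologicalSpace K] [IsTopologicalDivisionRing K] {f : X → Matrix (Fin n) (Fin n) K}
    (hf : Continuous f) (hdet : ∀ x, IsUnit (f x).det) :
    Continuous fun x => Matrix.GeneralLinearGroup.mk'' (f x) (hdet x) := by
  refine Units.continuous_iff.2 ⟨hf, ?_⟩
  have h : (fun x => ((Matrix.GeneralLinearGroup.mk'' (f x) (hdet x))⁻¹ :
      GL (Fin n) K).val) = fun x => ((f x).det)⁻¹ • (f x).adjugate := by
    refine funext fun x => ?_
    rw [← Ring.inverse_eq_inv', ← Matrix.inv_def]
    exact Matrix.coe_units_inv _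
  change Continuous fun x => ((Matrix.GeneralLinearGroup.mk'' (f x) (hdet x))⁻¹ :
      GL (Fin n) K).val
  rw [h]
  exact (hf.matrix_det.inv₀ fun x => (hdet x).ne_zero).smul hf.matrix_adjugate

lemma continuous_heegnerObject (w : Module.Basis (Fin n) ℚ F)
    (o : mixedEmbedding.index F ≃ Fin n) (c : ∀ p : S, PadicFrame F p.1.1 n)
    (e : ∀ p : S, PlaceAbove F p.1.1 → ℤ) : Continuous (heegnerObject w o c e) := by
  refine Continuous.prodMk ?_ (continuous_pi fun p => ?_)
  · refine continuous_quotient_mk'.comp (continuous_generalLinearGroup_mk'' ?_ _)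
    refine continuous_matrix fun i j => Continuous.mul ?_ continuous_const
    exact continuous_subtype_val.comp ((continuous_apply _).comp
      (continuous_fst.comp continuous_subtype_val))
  -- The source is a finite product of discrete groups, hence discrete.
  · have h1 : Continuous fun t : PlaceAbove F p.1.1 → primePowers p.1.1 =>
        (QuotientGroup.mk (Matrix.GeneralLinearGroup.mk'' _
          (isUnit_det_padicMatrix w (c p) (e p) t)) : PadicSpace n p.1.1) :=
      continuous_of_discreteTopology
    exact h1.comp ((continuous_apply p).comp (continuous_snd.comp continuous_subtype_val))

end Continuity

/-! ### A compact set meeting every coset of the period lattice -/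

section Cocompact
variable {F : Type*} [Field F] [NumberField F] {n : ℕ} {S : Finset RatPrime}
open Units.dirichletUnitTheorem

/-- A first period moves the finite part into the finite set `R`, whatever it does at infinity. A
second one, from a unit, leaves the finite part alone and brings the logarithms into a ball. -/
lemma exists_isCompact_mul_periodLattice (hS : IsUnramifiedIn F S) (w : Module.Basis (Fin n) ℚ F)
    (o : mixedEmbedding.index F ≃ Fin n) (c : ∀ p : S, PadicFrame F p.1.1 n)
    (e : ∀ p : S, PlaceAbove F p.1.1 → ℤ) :
    ∃ C : Set (normOneTorus F S), IsCompact C ∧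
      ∀ t, ∃ s ∈ C, ∃ ρ ∈ periodLattice (heegnerObject w o c e), t = s * ρ := by
  classical
  obtain ⟨M, hM0, hM⟩ := exists_pow_unit_mem_periodLattice w o c e
  obtain ⟨M', hM'0, hM'⟩ := exists_pow_eq_of_mem_periodLattice hS w o c e
  obtain ⟨r, hr⟩ := exists_norm_sub_logEmbedding_le F
  obtain ⟨R, hRfin, hR, hRrep⟩ := exists_finite_representatives_pow (F := F) (S := S) M' hM'0
  let G : R → logSpace F → normOneTorus F S := fun δ y =>
    ⟨(expVector y, δ.1), prod_expVector y, hR δ.1 δ.2⟩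
  have hG : ∀ δ, Continuous (G δ) := fun δ =>
    (continuous_expVector.prodMk continuous_const).subtype_mk _
  have : Finite R := hRfin
  refine ⟨⋃ δ, G δ '' Metric.closedBall 0 (M * r),
    isCompact_iUnion fun δ => (isCompact_closedBall _ _).image (hG δ), fun t => ?_⟩
  obtain ⟨δ₀, hδ₀, η, hη, hδ⟩ := hRrep t.1.2 t.2.2
  obtain ⟨ρ₁, hρ₁, hρ₁δ⟩ := hM' η hη
  -- Only `u ^ M` yields a period, so the vector is divided by `M` before approximating; this is why
  -- the ball has radius `M * r`.
  obtain ⟨u, hu⟩ := hr ((M : ℝ)⁻¹ • logVector (t * ρ₁⁻¹).1.1)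
  obtain ⟨ρ₂, hρ₂, hρ₂δ, hρ₂u⟩ := hM u
  have hMr : (M : ℝ) ≠ 0 := Nat.cast_ne_zero.2 hM0.ne'
  refine ⟨t * ρ₁⁻¹ * ρ₂⁻¹, Set.mem_iUnion.2 ⟨⟨δ₀, hδ₀⟩, logVector (t * ρ₁⁻¹ * ρ₂⁻¹).1.1, ?_, ?_⟩,
    ρ₂ * ρ₁, mul_mem hρ₂ hρ₁, by group⟩
  · have h1 : logVector (t * ρ₁⁻¹ * ρ₂⁻¹).1.1 = (M : ℝ) • ((M : ℝ)⁻¹ • logVector (t * ρ₁⁻¹).1.1 -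
        Units.logEmbedding F (Additive.ofMul u)) := by
      rw [smul_sub, smul_inv_smul₀ hMr]
      refine funext fun v => ?_
      rw [Pi.sub_apply, Pi.smul_apply, logEmbedding_component, smul_eq_mul]
      have h2 : ((t * ρ₁⁻¹ * ρ₂⁻¹).1.1 v.1 : ℝ) = (t * ρ₁⁻¹).1.1 v.1 * (v.1 u ^ M)⁻¹ := by
        rw [← hρ₂u]
        rfl
      rw [logVector, h2, Real.log_mul ((t * ρ₁⁻¹).1.1 v.1).2.ne'
        (inv_ne_zero (pow_ne_zero _ (Units.pos_at_place u v.1).ne')), Real.log_inv, Real.log_pow,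
        logVector]
      ring
    rw [mem_closedBall_zero_iff, h1, norm_smul, Real.norm_natCast]
    exact mul_le_mul_of_nonneg_left hu (Nat.cast_nonneg _)
  · refine Subtype.ext (Prod.ext (expVector_logVector _ (t * ρ₁⁻¹ * ρ₂⁻¹).2.1) ?_)
    change δ₀ = t.1.2 * (ρ₁.1.2)⁻¹ * (ρ₂.1.2)⁻¹
    rw [hρ₁δ, hρ₂δ, hδ, inv_one, mul_one, mul_inv_cancel_right]

end Cocompact

end Heegner

theorem theorem2p7 (F : Type*) [Field F] [NumberField F] (n : ℕ) (S : Finset Heegner.RatPrime)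
    (hS : Heegner.IsUnramifiedIn F S)
    (w : Module.Basis (Fin n) ℚ F)
    (o : NumberField.mixedEmbedding.index F ≃ Fin n)
    (c : ∀ p : S, Heegner.PadicFrame F p.1.1 n)
    (e : ∀ p : S, Heegner.PlaceAbove F p.1.1 → ℤ) :
    CompactSpace
      (Heegner.normOneTorus F S ⧸ Heegner.periodLattice (Heegner.heegnerObject w o c e)) ∧
    IsCompact (Set.range fun t : Heegner.normOneTorus F S =>
      (Quotient.mk _ (Heegner.heegnerObject w o c e t) : Heegner.GammaQuotient n S)) := by
  obtain ⟨C, hC, hCΛ⟩ := Heegner.exists_isCompact_mul_periodLattice hS w o c e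
  constructor
  · refine ⟨?_⟩
    have h : (Set.univ : Set (Heegner.normOneTorus F S ⧸
        Heegner.periodLattice (Heegner.heegnerObject w o c e))) = QuotientGroup.mk '' C := by
      refine (Set.eq_univ_of_forall fun y => ?_).symm
      obtain ⟨t, rfl⟩ := QuotientGroup.mk_surjective y
      obtain ⟨s, hs, ρ, hρ, rfl⟩ := hCΛ t
      exact ⟨s, hs, (QuotientGroup.mk_mul_of_mem s hρ).symm⟩
    rw [h]
    exact hC.image continuous_quotient_mk'
  · have hcont : Continuous fun t : Heegner.normOneTorus F S =>
        (Quotient.mk _ (Heegner.heegnerObject w o c e t) : Heegner.GammaQuotient n S) :=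
      continuous_quotient_mk'.comp (Heegner.continuous_heegnerObject w o c e)
    have h : (Set.range fun t : Heegner.normOneTorus F S =>
        (Quotient.mk _ (Heegner.heegnerObject w o c e t) : Heegner.GammaQuotient n S)) =
        (fun t : Heegner.normOneTorus F S =>
          (Quotient.mk _ (Heegner.heegnerObject w o c e t) : Heegner.GammaQuotient n S)) '' C := by
      refine (Set.image_subset_range _ _).antisymm' ?_
      rintro _ ⟨t, rfl⟩
      -- The matrix `A` attached to the period `ρ` carries the point of `s` to that of `s * ρ`, so
      -- `C` already has the full image.
      obtain ⟨s, hs, ρ, ⟨A, hA⟩, rfl⟩ := hCΛ t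
      refine ⟨s, hs, Quotient.sound ?_⟩
      rw [mul_comm s ρ, ← hA s]
      exact (MulAction.orbitRel _ _).symm ⟨A, rfl⟩
    rw [h]
    exact hC.image hcont
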